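/- **Setting.** Let $\Omega$ be a real or complex normed space with Schauder basis $(\Phi_i)_{i\ge1}$ (with continuous coordinate functionals), and let $L_{\rm bound}(\Omega)$ be the set of all $v=\sum_{i\ge1} b_i\Phi_i\in\Omega$ with real $b_i\in(-\tfrac12,\tfrac12)$ for every $i$. Let $\mathbb K$ be the set of integer sequences $\mathbf k=(k_1,k_2,\dots)$ with finitely many nonzero entries, $|\mathbf k|_1=\sum_i|k_i|$, $N_{\mathbf k}=\max\{i:k_i\neq0\}$ (with $N_{\mathbf 0}=0$), and $e_{\mathbf k}(\sum_i b_i\Phi_i)=\exp(2\pi \mathrm i\sum_i k_ib_i)$. A *$C^r$ decomposition* of a functional $f:L_{\rm bound}(\Omega)\to\mathbb R$ consists of finite sets $D_j\subset\{1,2,\dots\}$ and real functionals $f_j$, $j\ge1$, such that $f(\sum_i b_i\Phi_i)=\sum_{j\ge1}f_j(\sum_{i\in D_j}b_i\Phi_i)$ on $L_{\rm bound}(\Omega)$; each $f_j(\sum_{i\in D_j}b_i\Phi_i)$ is a $C^r$ and integrable function of $(b_i)_{i\in D_j}\in(-\tfrac12,\tfrac12)^{D_j}$; and, with $$\widehat{f_j}(\mathbf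 k)=\int_{(-\frac12,\frac12)^{D_j}}f_j\Big(\sum_{i\in D_j}b_i\Phi_i\Big)\prod_{i\in D_j}e^{-2\pi \mathrm i k_ib_i}\,db_i ,$$ one has $\sum_{\mathbf k\in\mathbb K}\ \sum_{j:\ \operatorname{supp}\mathbf k\subset D_j}|\widehat{f_j}(\mathbf k)|<\infty$. The Fourier coefficients of $f$ are $a_{\mathbf k}(f)=\sum_{j:\ \operatorname{supp}\mathbf k\subset D_j}\widehat{f_j}(\mathbf k)$, for a decomposition for which $f(v)=\sum_{\mathbf k\in\mathbb K}a_{\mathbf k}(f)e_{\mathbf k}(v)$ on $L_{\rm bound}(\Omega)$; they do not depend on this decomposition. The Barron spectral space $\mathfrak B$ consists of the continuous functionals $f:L_{\rm bound}(\Omega)\to\mathbb R$ that have a $C^1$ decomposition, satisfy $f=\sum_{\mathbf k}a_{\mathbf k}(f)e_{\mathbf k}$ pointwise, and have $$\|f\|_{\mathfrak B}=\sum_{\mathbf k\in\mathbb K}\big(1+(2\pi)^2|\mathbf k|_1^2\big)|a_{\mathbf k}(f)|<\infty .$$ The space $\mathcal H$ consists of the functionals $f:L_{\rm bound}(\Omega)\to\mathbb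 R$ that have a $C^0$ decomposition, satisfy $f=\sum_{\mathbf k}a_{\mathbf k}(f)e_{\mathbf k}$ pointwise, and have $$\|f\|_{\mathcal H}^2=\sum_{\mathbf k\in\mathbb K}\big(1+(2\pi)^2|\mathbf k|_1^2\big)|a_{\mathbf k}(f)|^2<\infty .$$ **Theorem.** Let $f\in\mathfrak B$ be non-constant and let $m\ge1$ be an integer. Then there are real numbers $c,\gamma_1,\dots,\gamma_m,t_1,\dots,t_m$, multi-indices $\mathbf k_1,\dots,\mathbf k_m\in\mathbb K$ with $a_{\mathbf k_j}(f)\neq0$, and vectors $\mathbf w_j=(w_{1j},\dots,w_{N_{\mathbf k_j}j})\in\mathbb R^{N_{\mathbf k_j}}$ with $$2|c|\le4\|f\|_{\mathfrak B},\qquad \sum_{j=1}^m|\gamma_j|\le4\|f\|_{\mathfrak B},\qquad |\mathbf w_j|_1=1,\qquad |t_j|\le1 ,$$ such that the network $$f_m\Big(\sum_{i\ge1}b_i\Phi_i\Big)=c+\sum_{j=1}^m\gamma_j\,\mathrm{ReLU}\Big(\sum_{i=1}^{N_{\mathbf k_j}}w_{ij}b_i-t_j\Big)$$ satisfies $f-f_m\in\mathcal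 H$ and $$\|f-f_m\|_{\mathcal H}\le\frac{4\sqrt5\,\|f\|_{\mathfrak B}}{\sqrt m}.$$ -/

import Mathlib

open Filter Topology MeasureTheory

noncomputable section

namespace BarronFunctional

variable {𝕜 Ω : Type*} [RCLike 𝕜] [NormedAddCommGroup Ω] [NormedSpace 𝕜 Ω]

/-- The `ℓ¹` norm of an integer multi-index with finitely many nonzero entries. The type
`ℕ →₀ ℤ` is the index set of the Fourier basis of functionals (coordinates start at `0`). -/
def l1 (k : ℕ →₀ ℤ) : ℝ := ∑ i ∈ k.support, |(k i : ℝ)|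

/-- The length of a multi-index: the least `N` such that `k i = 0` for all `i ≥ N`. With the
coordinates numbered from `1` this is the largest position of a nonzero entry; it is `0` for
`k = 0`. -/
def len (k : ℕ →₀ ℤ) : ℕ := k.support.sup (fun i => i + 1)

/-- The domain of the functionals: the `v = ∑ bᵢ Φᵢ` whose coefficients are real numbers in
`(-1/2, 1/2)`. -/
def LBound (Φ : SchauderBasis 𝕜 Ω) : Set Ω :=
  {v | ∀ i, ∃ x : ℝ, x ∈ Set.Ioo (-(1 / 2) : ℝ) (1 / 2) ∧ Φ.coord i v = (x : 𝕜)}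

/-- The real coefficient `bᵢ` of `v = ∑ bᵢ Φᵢ`. -/
def coef (Φ : SchauderBasis 𝕜 Ω) (v : LBound Φ) (i : ℕ) : ℝ := RCLike.re (Φ.coord i (v : Ω))

/-- The Fourier basis functional `e_k (∑ bᵢ Φᵢ) = exp (∑ 2 π i kᵢ bᵢ)`. -/
def basisFn (Φ : SchauderBasis 𝕜 Ω) (k : ℕ →₀ ℤ) (v : LBound Φ) : ℂ :=
  Complex.exp (∑ i ∈ k.support, 2 * Real.pi * Complex.I * (k i : ℂ) * (coef Φ v i : ℂ))

/-- The open unit cube `(-1/2, 1/2)^D`. -/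
def cube (D : Finset ℕ) : Set (D → ℝ) :=
  Set.univ.pi fun _ => Set.Ioo (-(1 / 2) : ℝ) (1 / 2)

/-- A functional `F` read in the coordinates `(bᵢ)`, `i ∈ D`, on the span of `Φᵢ`, `i ∈ D`. -/
def onSpan (Φ : SchauderBasis 𝕜 Ω) (D : Finset ℕ) (F : Ω → ℝ) (b : D → ℝ) : ℝ :=
  F (∑ i : D, (b i : 𝕜) • Φ.basis i)

/-- The Fourier coefficient at `k` of `F`, as a function on the cube `(-1/2, 1/2)^D`. -/
def pieceCoeff (Φ : SchauderBasis 𝕜 Ω) (D : Finset ℕ) (F : Ω → ℝ) (k : ℕ →₀ ℤ) : ℂ :=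
  ∫ b in cube D, (onSpan Φ D F b : ℂ) *
    ∏ i : D, Complex.exp (-(2 * Real.pi * Complex.I * (k i : ℂ) * (b i : ℂ)))

/-- A decomposition `f (∑ᵢ bᵢ Φᵢ) = ∑ⱼ Fⱼ (∑_{i ∈ Dⱼ} bᵢ Φᵢ)` of a functional into functionals of
finitely many coefficients, each of class `C^r` and integrable on its cube, for which the double
series of the Fourier coefficients of the pieces converges absolutely. -/
structure FourierDecomp (Φ : SchauderBasis 𝕜 Ω) (r : ℕ) (f : LBound Φ → ℝ) where
  D : ℕ → Finset ℕ
  F : ℕ → Ω → ℝ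
  tendsto_sum : ∀ v : LBound Φ,
    Tendsto (fun n => ∑ j ∈ Finset.range n, F j (∑ i ∈ D j, (coef Φ v i : 𝕜) • Φ.basis i))
      atTop (𝓝 (f v))
  contDiffOn : ∀ j, ContDiffOn ℝ r (onSpan Φ (D j) (F j)) (cube (D j))
  integrableOn : ∀ j, IntegrableOn (onSpan Φ (D j) (F j)) (cube (D j))
  summable : Summable fun p : (ℕ →₀ ℤ) × ℕ =>
    if p.1.support ⊆ D p.2 then ‖pieceCoeff Φ (D p.2) (F p.2) p.1‖ else 0

/-- The Fourier coefficient at `k` computed from a decomposition: the sum, over the `j` for which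
`k` vanishes outside `Dⱼ`, of the Fourier coefficients of the pieces. -/
def FourierDecomp.coeff {Φ : SchauderBasis 𝕜 Ω} {r : ℕ} {f : LBound Φ → ℝ}
    (d : FourierDecomp Φ r f) (k : ℕ →₀ ℤ) : ℂ :=
  ∑' j, if k.support ⊆ d.D j then pieceCoeff Φ (d.D j) (d.F j) k else 0

/-- `f` is the sum of its Fourier series, with coefficients `a` that come from a decomposition of
`f` into pieces of class `C^r`. -/
def HasFourierSeries (Φ : SchauderBasis 𝕜 Ω) (r : ℕ) (f : LBound Φ → ℝ)
    (a : (ℕ →₀ ℤ) → ℂ) : Prop :=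
  (∃ d : FourierDecomp Φ r f, ∀ k, a k = d.coeff k) ∧
    ∀ v : LBound Φ, HasSum (fun k => a k * basisFn Φ k v) (f v : ℂ)

open Classical in
/-- The Fourier coefficients `a_k (f)`; they do not depend on the choice of the decomposition, nor
on the class of its pieces, by `HasFourierSeries.unique` and `HasFourierSeries.fourierCoef_eq`. -/
def fourierCoef (Φ : SchauderBasis 𝕜 Ω) (f : LBound Φ → ℝ) : (ℕ →₀ ℤ) → ℂ :=
  if h : ∃ a, HasFourierSeries Φ 0 f a then h.choose else 0

/-- The exponential `e_k` in coefficient form. -/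
def expSum (k : ℕ →₀ ℤ) (b : ℕ → ℝ) : ℂ :=
  Complex.exp (∑ i ∈ k.support, 2 * Real.pi * Complex.I * (k i : ℂ) * (b i : ℂ))

lemma norm_expSum (k : ℕ →₀ ℤ) (b : ℕ → ℝ) : ‖expSum k b‖ = 1 := by
  have : (∑ i ∈ k.support, 2 * Real.pi * Complex.I * (k i : ℂ) * (b i : ℂ))
      = ((∑ i ∈ k.support, 2 * Real.pi * (k i : ℝ) * b i : ℝ) : ℂ) * Complex.I := by
    push_cast
    rw [Finset.sum_mul]
    exact Finset.sum_congr rfl fun i _ => by ring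
  rw [expSum, this, Complex.norm_exp_ofReal_mul_I]

lemma expSum_update (k : ℕ →₀ ℤ) (b : ℕ → ℝ) (i : ℕ) (x : ℝ) :
    expSum k (Function.update b i x) =
      Complex.exp (2 * Real.pi * Complex.I * (k i : ℂ) * (x : ℂ)) *
        expSum k (Function.update b i 0) := by
  rw [expSum, expSum, ← Complex.exp_add]
  congr 1
  rw [← sub_eq_iff_eq_add, ← Finset.sum_sub_distrib]
  have : ∀ j ∈ k.support, (2 * Real.pi * Complex.I * (k j : ℂ) * (Function.update b i x j : ℂ) -
      2 * Real.pi * Complex.I * (k j : ℂ) * (Function.update b i 0 j : ℂ)) =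
      if j = i then 2 * Real.pi * Complex.I * (k i : ℂ) * (x : ℂ) else 0 := by
    intro j _
    by_cases h : j = i
    · subst h; simp
    · simp [h]
  rw [Finset.sum_congr rfl this, Finset.sum_ite_eq']
  by_cases h : i ∈ k.support
  · simp [h]
  · simp [h, Finsupp.notMem_support_iff.1 h]

lemma integral_exp (n : ℤ) :
    ∫ x in (-(1 / 2) : ℝ)..(1 / 2), Complex.exp (2 * Real.pi * Complex.I * (n : ℂ) * (x : ℂ)) =
      if n = 0 then 1 else 0 := by
  by_cases h : n = 0
  · simp [h]; norm_num
  · have hc : (2 * Real.pi * Complex.I * (n : ℂ)) ≠ 0 := by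
      simp [h, Real.pi_ne_zero]
    rw [integral_exp_mul_complex hc, if_neg h]
    have : Complex.exp (2 * Real.pi * Complex.I * (n : ℂ) * ((1 / 2 : ℝ) : ℂ)) =
        Complex.exp (2 * Real.pi * Complex.I * (n : ℂ) * ((-(1 / 2) : ℝ) : ℂ)) := by
      rw [Complex.exp_eq_exp_iff_exists_int]
      exact ⟨n, by push_cast; ring⟩
    rw [this, sub_self, zero_div]

lemma restrict_step {c : (ℕ →₀ ℤ) → ℂ} (hc : Summable fun k => ‖c k‖)
    (h : ∀ b : ℕ → ℝ, (∀ i, b i ∈ Set.Ioo (-(1 / 2) : ℝ) (1 / 2)) → b.support.Finite →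
      ∑' k, c k * expSum k b = 0) (i : ℕ) (κ : ℤ) :
    ∀ b : ℕ → ℝ, (∀ i, b i ∈ Set.Ioo (-(1 / 2) : ℝ) (1 / 2)) → b.support.Finite →
      ∑' k, (if k i = κ then c k else 0) * expSum k b = 0 := by
  intro b hb hbf
  let G : (ℕ →₀ ℤ) → ℝ → ℂ := fun k x =>
    c k * expSum k (Function.update b i 0) *
      Complex.exp (2 * Real.pi * Complex.I * ((k i - κ : ℤ) : ℂ) * (x : ℂ))
  have hG : ∀ k x, G k x = Complex.exp (-(2 * Real.pi * Complex.I * (κ : ℂ) * (x : ℂ))) *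
      (c k * expSum k (Function.update b i x)) := by
    intro k x
    simp only [G]
    rw [expSum_update k b i x]
    have : Complex.exp (2 * Real.pi * Complex.I * ((k i - κ : ℤ) : ℂ) * (x : ℂ)) =
        Complex.exp (-(2 * Real.pi * Complex.I * (κ : ℂ) * (x : ℂ))) *
        Complex.exp (2 * Real.pi * Complex.I * (k i : ℂ) * (x : ℂ)) := by
      rw [← Complex.exp_add]; congr 1; push_cast; ring
    rw [this]; ring
  have hnG : ∀ k x, ‖G k x‖ = ‖c k‖ := by
    intro k x
    rw [hG, norm_mul, norm_mul, norm_expSum, mul_one]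
    have : -(2 * Real.pi * Complex.I * (κ : ℂ) * (x : ℂ)) =
        ((-(2 * Real.pi * κ * x) : ℝ) : ℂ) * Complex.I := by push_cast; ring
    rw [this, Complex.norm_exp_ofReal_mul_I, one_mul]
  have hcont : ∀ k, Continuous (G k) := fun k => by fun_prop
  have hint : HasSum (fun k => ∫ x in Set.Ioo (-(1 / 2) : ℝ) (1 / 2), G k x)
      (∫ x in Set.Ioo (-(1 / 2) : ℝ) (1 / 2), ∑' k, G k x) := by
    apply hasSum_integral_of_summable_integral_norm
    · intro k
      exact ((hcont k).integrableOn_Icc (a := -(1 / 2)) (b := 1 / 2)).mono_set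
        Set.Ioo_subset_Icc_self
    · simpa [hnG] using hc.mul_left _
  have hz : ∫ x in Set.Ioo (-(1 / 2) : ℝ) (1 / 2), ∑' k, G k x = 0 := by
    rw [setIntegral_congr_fun (g := fun _ => (0 : ℂ)) measurableSet_Ioo]
    · simp
    · intro x hx
      simp only [hG, tsum_mul_left]
      rw [h (Function.update b i x), mul_zero]
      · intro j
        by_cases hj : j = i
        · subst hj; simpa using hx
        · simpa [hj] using hb j
      · exact (hbf.union (Set.finite_singleton i)).subset fun j hj => by
          by_cases hji : j = i
          · right; exact hji
          · left; simpa [hji] using hj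
  rw [hz] at hint
  have hval : ∀ k, ∫ x in Set.Ioo (-(1 / 2) : ℝ) (1 / 2), G k x =
      (if k i = κ then c k else 0) * expSum k (Function.update b i 0) := by
    intro k
    rw [← integral_Ioc_eq_integral_Ioo,
      ← intervalIntegral.integral_of_le (by norm_num : (-(1 / 2) : ℝ) ≤ 1 / 2)]
    simp only [G]
    rw [intervalIntegral.integral_const_mul, integral_exp]
    by_cases hk : k i = κ
    · simp [hk]
    · simp [hk, sub_eq_zero]
  simp only [hval] at hint
  have hb' : ∀ k, (if k i = κ then c k else 0) * expSum k b =
      Complex.exp (2 * Real.pi * Complex.I * (κ : ℂ) * (b i : ℂ)) *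
        ((if k i = κ then c k else 0) * expSum k (Function.update b i 0)) := by
    intro k
    have := expSum_update k b i (b i)
    rw [Function.update_eq_self] at this
    by_cases hk : k i = κ
    · rw [this, hk]; ring
    · simp [hk]
  simp only [hb', tsum_mul_left, hint.tsum_eq, mul_zero]

lemma coeff_eq_zero {c : (ℕ →₀ ℤ) → ℂ} (hc : Summable fun k => ‖c k‖)
    (h : ∀ b : ℕ → ℝ, (∀ i, b i ∈ Set.Ioo (-(1 / 2) : ℝ) (1 / 2)) → b.support.Finite →
      ∑' k, c k * expSum k b = 0) (κ : ℕ →₀ ℤ) : c κ = 0 := by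
  classical
  let cn : ℕ → (ℕ →₀ ℤ) → ℂ := fun n k => if ∀ i < n, k i = κ i then c k else 0
  have hle : ∀ n k, ‖cn n k‖ ≤ ‖c k‖ := by
    intro n k
    simp only [cn]
    split_ifs <;> simp
  have hn : ∀ n, ∀ b : ℕ → ℝ, (∀ i, b i ∈ Set.Ioo (-(1 / 2) : ℝ) (1 / 2)) → b.support.Finite →
      ∑' k, cn n k * expSum k b = 0 := by
    intro n
    induction n with
    | zero => simpa [cn] using h
    | succ n ih =>
      have := restrict_step (hc.of_nonneg_of_le (fun _ => norm_nonneg _) (hle n)) ih n (κ n)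
      intro b hb hbf
      rw [← this b hb hbf]
      congr 1; ext k; congr 1
      simp only [cn, Nat.lt_succ_iff_lt_or_eq]
      by_cases h1 : k n = κ n
      · simp only [h1, if_true]
        congr 1
        exact propext ⟨fun H i hi => H i (Or.inl hi), fun H i hi => hi.elim (H i) (fun e => e ▸ h1)⟩
      · rw [if_neg h1, if_neg fun H => h1 (H n (Or.inr rfl))]
  have h0 : ∀ n, ∑' k, cn n k = 0 := by
    intro n
    have := hn n (fun _ => 0) (fun i => by norm_num) (by simp)
    simpa [expSum] using this
  have hlim : Tendsto (fun n => ∑' k, cn n k) atTop (𝓝 (∑' k, if k = κ then c k else 0)) := by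
    refine tendsto_tsum_of_dominated_convergence hc (fun k => ?_)
      (Eventually.of_forall fun n k => hle n k)
    by_cases hk : k = κ
    · subst hk; simp [cn]
    · obtain ⟨i, hi⟩ : ∃ i, k i ≠ κ i := by
        by_contra! H
        exact hk (Finsupp.ext H)
      refine tendsto_const_nhds.congr' ?_
      filter_upwards [eventually_gt_atTop i] with n hni
      simp only [cn, hk, if_false]
      rw [if_neg fun H => hi (H i hni)]
  simp only [h0, tsum_ite_eq] at hlim
  exact (tendsto_nhds_unique hlim tendsto_const_nhds)

/-- The coefficients of the Fourier series of a functional are unique. -/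
theorem HasFourierSeries.unique {Φ : SchauderBasis 𝕜 Ω} {r r' : ℕ} {f : LBound Φ → ℝ}
    {a a' : (ℕ →₀ ℤ) → ℂ} (h : HasFourierSeries Φ r f a) (h' : HasFourierSeries Φ r' f a') :
    a = a' := by
  have key : ∀ b : ℕ → ℝ, (∀ i, b i ∈ Set.Ioo (-(1 / 2) : ℝ) (1 / 2)) → b.support.Finite →
      HasSum (fun k => (a k - a' k) * expSum k b) 0 := by
    intro b hb hbf
    have hco : ∀ i, Φ.coord i (∑ j ∈ hbf.toFinset, (b j : 𝕜) • Φ.basis j) = (b i : 𝕜) := by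
      intro i
      simp only [map_sum, map_smul, Φ.ortho, Pi.single_apply, smul_eq_mul, mul_ite, mul_one,
        mul_zero]
      rw [Finset.sum_ite_eq]
      by_cases hi : b i = 0 <;> simp [hi]
    let v : LBound Φ := ⟨∑ j ∈ hbf.toFinset, (b j : 𝕜) • Φ.basis j, fun i => ⟨b i, hb i, hco i⟩⟩
    have hv : ∀ k, basisFn Φ k v = expSum k b := by
      intro k
      simp [basisFn, expSum, coef, v, -map_sum, hco]
    have := (h.2 v).sub (h'.2 v)
    simpa [hv, sub_mul] using this
  funext k
  refine sub_eq_zero.1 (coeff_eq_zero (c := fun k => a k - a' k) ?_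
    (fun b hb hbf => (key b hb hbf).tsum_eq) k)
  have := (key (fun _ => 0) (fun i => by norm_num) (by simp)).summable
  simpa [expSum] using this.norm

/-- `fourierCoef` is the family of coefficients of the Fourier series, whenever there is one. -/
theorem HasFourierSeries.fourierCoef_eq {Φ : SchauderBasis 𝕜 Ω} {r : ℕ} {f : LBound Φ → ℝ}
    {a : (ℕ →₀ ℤ) → ℂ} (h : HasFourierSeries Φ r f a) : fourierCoef Φ f = a := by
  have hex : ∃ a, HasFourierSeries Φ 0 f a := by
    obtain ⟨⟨d, hd⟩, hs⟩ := h
    refine ⟨a, ⟨⟨d.D, d.F, d.tendsto_sum, fun j => ?_, d.integrableOn, d.summable⟩, hd⟩, hs⟩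
    exact (d.contDiffOn j).of_le (by simp)
  rw [fourierCoef, dif_pos hex]
  exact hex.choose_spec.unique h

/-- Membership in the Barron spectral space of order `s`: continuous functionals with a
decomposition into `C¹` pieces that are the sum of their Fourier series and have a finite norm. -/
def MemBarron (Φ : SchauderBasis 𝕜 Ω) (s : ℕ) (f : LBound Φ → ℝ) : Prop :=
  Continuous f ∧ HasFourierSeries Φ 1 f (fourierCoef Φ f) ∧
    Summable fun k => (1 + (2 * Real.pi) ^ s * l1 k ^ s) * ‖fourierCoef Φ f k‖

/-- The norm of the Barron spectral space of order `s`. -/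
def barronNorm (Φ : SchauderBasis 𝕜 Ω) (s : ℕ) (f : LBound Φ → ℝ) : ℝ :=
  ∑' k, (1 + (2 * Real.pi) ^ s * l1 k ^ s) * ‖fourierCoef Φ f k‖

/-- Membership in the Hilbert space of order `s`. The pieces are only required to be continuous,
since ReLU networks are not of class `C¹`. -/
def MemHilbert (Φ : SchauderBasis 𝕜 Ω) (s : ℕ) (f : LBound Φ → ℝ) : Prop :=
  HasFourierSeries Φ 0 f (fourierCoef Φ f) ∧
    Summable fun k => (1 + (2 * Real.pi) ^ (2 * s) * l1 k ^ (2 * s)) * ‖fourierCoef Φ f k‖ ^ 2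

/-- The norm of the Hilbert space of order `s`. -/
def hilbertNorm (Φ : SchauderBasis 𝕜 Ω) (s : ℕ) (f : LBound Φ → ℝ) : ℝ :=
  √(∑' k, (1 + (2 * Real.pi) ^ (2 * s) * l1 k ^ (2 * s)) * ‖fourierCoef Φ f k‖ ^ 2)

/-- The two-layer ReLU networks with `m` hidden units attached to `f`. -/
def reluNetworks (Φ : SchauderBasis 𝕜 Ω) (f : LBound Φ → ℝ) (m : ℕ) : Set (LBound Φ → ℝ) :=
  {g | ∃ (c : ℝ) (γ t : Fin m → ℝ) (k : Fin m → (ℕ →₀ ℤ)) (w : Fin m → ℕ → ℝ),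
    2 * |c| ≤ 4 * barronNorm Φ 2 f ∧
    ∑ j, |γ j| ≤ 4 * barronNorm Φ 2 f ∧
    (∀ j, fourierCoef Φ f (k j) ≠ 0) ∧
    (∀ j, ∑ i ∈ Finset.range (len (k j)), |w j i| = 1) ∧
    (∀ j, |t j| ≤ 1) ∧
    ∀ v, g v =
      c + ∑ j, γ j * max 0 (∑ i ∈ Finset.range (len (k j)), w j i * coef Φ v i - t j)}

end BarronFunctional

end

noncomputable section

namespace BarronFunctional

/-! The network is found by the probabilistic method, using exact periodic triangle waves. The wave
`triWave` has Fourier coefficient `1 / q²` at odd `q` and `0` at even `q` (`hasSum_triWave`). For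
`‖u‖ ≤ 1`, let the phase `s` have density `1 + Re (u exp (2πis))`. This density only sees the
frequencies `0` and `±1`, so the mean of `triWave (z - s)` is exactly `Re (u exp (2πiz))`
(`integral_phaseMeasure`, `integral_waveCoeff_sub_cosCoeff`). A real trigonometric term is thus an
average of triangle waves in its own direction `k`, whose deviation has squared norm at most `10 *
weight k` (`summable_waveBound`). On the cube `∑ kᵢ bᵢ` ranges over an interval of length `|k|₁`, so
such a wave costs `2 |k|₁ + 1 ≤ weight k` ReLU units (`exists_relu_triWave`).

Let `A` be the Barron norm of `f` and `ε = A / m`. Frequencies with `‖a k‖ < ε` are dropped, at a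
cost of at most `ε A` in squared norm. Each other nonzero `k` gets `⌊‖a k‖ / ε⌋` waves of equal
amplitude, at most `2 ε`, with total amplitude `‖a k‖`. The number of units is at most `∑ (‖a k‖ /
ε) weight k ≤ A / ε = m` (`netFn_mem_reluNetworks`). The deviations have mean zero, so the phases
can be chosen one by one without paying for cross terms (`exists_tsum_norm_add_sum_sq_le`); they add
at most `2 ε · 10 · A`. In total the squared error is at most `21 A² / m`, below the claimed `80 A²
/ m` (`exists_phases`).

That the error lies in the Hilbert space, with the expected coefficients, follows because the
network depends on finitely many coordinates and has an absolutely convergent Fourier series: it is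
one more piece of a decomposition (`HasFourierSeries.sub_finite`). -/

/-! ### The triangle wave -/

/-- The triangle wave of period `1`, normalized so that its Fourier coefficient at the odd
integer `q` is `1 / q²`. -/
def triWave (z : ℝ) : ℝ := Real.pi ^ 2 / 4 * (1 - 4 * ‖(z : UnitAddCircle)‖)

/-- The Fourier coefficients of `triWave`. -/
def triCoeff (q : ℤ) : ℝ := if Even q then 0 else 1 / (q : ℝ) ^ 2

/-- The affine function that agrees with the distance to the nearest integer on
`[j / 2, (j + 1) / 2]`. -/
def distLine (j : ℤ) (z : ℝ) : ℝ := if Even j then z - j / 2 else (j + 1) / 2 - z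

/-- The slope of `distLine j`. -/
def distSlope (j : ℤ) : ℝ := if Even j then 1 else -1

lemma abs_distSlope (j : ℤ) : |distSlope j| = 1 := by
  unfold distSlope; split_ifs <;> simp

lemma distLine_sub (j : ℤ) (z z₀ : ℝ) :
    distLine j z = distLine j z₀ + distSlope j * (z - z₀) := by
  unfold distLine distSlope; split_ifs <;> ring

/-- Consecutive affine pieces meet at the half-integer `(j + 1) / 2`, where the slope changes sign.
The jump in slope is the outer weight of the ReLU unit placed at that kink. -/
lemma distLine_succ_sub (j : ℤ) (z : ℝ) :
    distLine (j + 1) z - distLine j z = 2 * distSlope (j + 1) * (z - (j + 1) / 2) := by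
  unfold distLine distSlope
  by_cases h : Even j
  · rw [if_neg (by simpa [Int.even_add_one] using h), if_pos h,
      if_neg (by simpa [Int.even_add_one] using h)]
    push_cast; ring
  · rw [if_pos (Int.even_add_one.2 h), if_neg h, if_pos (Int.even_add_one.2 h)]
    push_cast; ring

lemma norm_coe_eq_distLine {j : ℤ} {z : ℝ} (h₁ : (j : ℝ) / 2 ≤ z) (h₂ : z ≤ (j + 1) / 2) :
    ‖(z : UnitAddCircle)‖ = distLine j z := by
  have key : ∀ n : ℤ, |z - n| ≤ 1 / 2 → ‖(z : UnitAddCircle)‖ = |z - n| := by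
    intro n hn
    have : (z : UnitAddCircle) = ((z - n : ℝ) : UnitAddCircle) := by
      have h1 : ((n : ℝ) : UnitAddCircle) = 0 := by
        rw [AddCircle.coe_eq_zero_iff]; exact ⟨n, by simp⟩
      rw [AddCircle.coe_sub, h1, sub_zero]
    rw [this, AddCircle.norm_coe_eq_abs_iff 1 one_ne_zero]
    simpa using hn
  unfold distLine
  by_cases h : Even j
  · obtain ⟨n, rfl⟩ := h
    have h0 : z - n = |z - n| := (abs_of_nonneg (by push_cast at h₁; linarith)).symm
    rw [if_pos ⟨n, rfl⟩, key n]
    · rw [← h0]; push_cast; ring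
    · rw [← h0]; push_cast at h₂; linarith
  · obtain ⟨n, rfl⟩ := Int.not_even_iff_odd.1 h
    have h0 : |z - (n + 1 : ℤ)| = (n + 1 : ℤ) - z := by
      rw [abs_of_nonpos] <;> push_cast at * <;> linarith
    rw [if_neg h, key (n + 1), h0]
    · push_cast; ring
    · rw [h0]; push_cast at *; linarith

/-- On an interval of length `n / 2` the distance to the nearest integer is a combination of
`n + 1` rectified linear units. -/
lemma norm_coe_eq_sum_relu (z₀ z : ℝ) (n : ℕ) (h₀ : z₀ ≤ z) (h₁ : z ≤ z₀ + n / 2) :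
    ‖(z : UnitAddCircle)‖ = ‖(z₀ : UnitAddCircle)‖ + distSlope ⌊2 * z₀⌋ * max 0 (z - z₀) +
      ∑ i ∈ Finset.range n, 2 * distSlope (⌊2 * z₀⌋ + i + 1) *
        max 0 (z - (⌊2 * z₀⌋ + i + 1) / 2) := by
  have hfl : ∀ y : ℝ, ‖(y : UnitAddCircle)‖ = distLine ⌊2 * y⌋ y := fun y =>
    norm_coe_eq_distLine (by linarith [Int.floor_le (2 * y)])
      (by linarith [Int.lt_floor_add_one (2 * y)])
  set p := ⌊2 * z₀⌋ with hp
  obtain ⟨r, hr⟩ : ∃ r : ℕ, ⌊2 * z⌋ = p + r := by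
    obtain ⟨r, hr⟩ := Int.eq_ofNat_of_zero_le
      (sub_nonneg.2 (Int.floor_mono (by linarith : 2 * z₀ ≤ 2 * z)))
    exact ⟨r, by simp only [hp]; omega⟩
  have hrn : r ≤ n := by
    have : ⌊2 * z⌋ ≤ ⌊2 * z₀ + n⌋ := Int.floor_mono (by linarith)
    rw [Int.floor_add_natCast] at this
    omega
  -- Kinks to the right of `z` give inactive units; the active ones telescope from the affine piece
  -- at `z₀` to the piece at `z`.
  have hsum : ∑ i ∈ Finset.range n, 2 * distSlope (p + i + 1) * max 0 (z - (p + i + 1) / 2) =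
      ∑ i ∈ Finset.range r, (distLine (p + (i + 1 : ℕ)) z - distLine (p + i) z) := by
    rw [← Finset.sum_subset (Finset.range_mono hrn)]
    · refine Finset.sum_congr rfl fun i hi => ?_
      have hi' : p + i + 1 ≤ ⌊2 * z⌋ := by have := Finset.mem_range.1 hi; omega
      have hle : ((p + i + 1 : ℤ) : ℝ) ≤ 2 * z := Int.le_floor.1 hi'
      push_cast at hle
      have e := distLine_succ_sub (p + i) z
      rw [max_eq_right (by linarith)]
      push_cast at e ⊢
      rw [← add_assoc, e]
    · intro i _ hi
      have hi' : ⌊2 * z⌋ < p + i + 1 := by have := mt Finset.mem_range.2 hi; omega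
      have hlt : 2 * z < ((p + i + 1 : ℤ) : ℝ) := Int.floor_lt.1 hi'
      push_cast at hlt
      rw [max_eq_left (by linarith), mul_zero]
  rw [hsum, Finset.sum_range_sub (fun i : ℕ => distLine (p + i) z), hfl z, hr, hfl z₀, ← hp,
    max_eq_right (by linarith), ← distLine_sub]
  simp

lemma triCoeff_zero : triCoeff 0 = 0 := by simp [triCoeff]

lemma triCoeff_nonneg (q : ℤ) : 0 ≤ triCoeff q := by
  unfold triCoeff; split_ifs <;> positivity

/-- This is the series of the second Bernoulli polynomial. Its mean is zero, in agreement with the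
value `1 / 0 = 0` of the term `n = 0`. -/
lemma hasSum_sq_fourier {x : ℝ} (hx : x ∈ Set.Icc (0 : ℝ) 1) :
    HasSum (fun n : ℤ => 1 / (n : ℂ) ^ 2 * Complex.exp (2 * Real.pi * Complex.I * n * x))
      ((2 * Real.pi ^ 2 * (x ^ 2 - x + 6⁻¹) : ℝ) : ℂ) := by
  have := hasSum_one_div_pow_mul_fourier_mul_bernoulliFun le_rfl hx
  rw [bernoulliFun_two] at this
  convert this using 1
  · ext n
    rw [fourier_coe_apply]
    simp
  · rw [mul_pow, mul_pow, Complex.I_sq]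
    push_cast [Nat.factorial]
    ring

lemma exp_add_half (q : ℤ) (z : ℝ) :
    Complex.exp (2 * Real.pi * Complex.I * q * ((z + 1 / 2 : ℝ) : ℂ)) =
      (if Even q then 1 else -1) * Complex.exp (2 * Real.pi * Complex.I * q * z) := by
  have : 2 * Real.pi * Complex.I * q * ((z + 1 / 2 : ℝ) : ℂ) =
      q * (Real.pi * Complex.I) + 2 * Real.pi * Complex.I * q * z := by push_cast; ring
  rw [this, Complex.exp_add, Complex.exp_int_mul, Complex.exp_pi_mul_I]
  split_ifs with h
  · rw [h.neg_one_zpow]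
  · rw [(Int.not_even_iff_odd.1 h).neg_one_zpow]

lemma exp_add_int (q n : ℤ) (z : ℝ) :
    Complex.exp (2 * Real.pi * Complex.I * q * ((z + n : ℝ) : ℂ)) =
      Complex.exp (2 * Real.pi * Complex.I * q * z) := by
  rw [Complex.exp_eq_exp_iff_exists_int]
  exact ⟨q * n, by push_cast; ring⟩

/-- Shifting by `1 / 2` multiplies the frequency `q` by `(-1)^q`. In half the difference of the
Bernoulli series at `y` and `y + 1 / 2`, even frequencies cancel, odd ones survive, and the
quadratic terms cancel to leave an affine function. -/
lemma hasSum_triWave_of_le_half {y : ℝ} (h₀ : 0 ≤ y) (h₁ : y ≤ 1 / 2) :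
    HasSum (fun q : ℤ => (triCoeff q : ℂ) * Complex.exp (2 * Real.pi * Complex.I * q * y))
      ((Real.pi ^ 2 / 4 * (1 - 4 * y) : ℝ) : ℂ) := by
  have H := ((hasSum_sq_fourier (x := y) ⟨h₀, by linarith⟩).sub
    (hasSum_sq_fourier (x := y + 1 / 2) ⟨by linarith, by linarith⟩)).mul_left (1 / 2)
  rw [show Real.pi ^ 2 / 4 * (1 - 4 * y) = 1 / 2 * (2 * Real.pi ^ 2 * (y ^ 2 - y + 6⁻¹) -
    2 * Real.pi ^ 2 * ((y + 1 / 2) ^ 2 - (y + 1 / 2) + 6⁻¹)) by ring]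
  push_cast at H ⊢
  refine H.congr_fun fun q => ?_
  have := exp_add_half q y
  push_cast at this
  rw [this]
  unfold triCoeff
  split_ifs
  · simp
  · push_cast; ring

/-- The Fourier series of the triangle wave. -/
lemma hasSum_triWave (z : ℝ) :
    HasSum (fun q : ℤ => (triCoeff q : ℂ) * Complex.exp (2 * Real.pi * Complex.I * q * z))
      (triWave z : ℂ) := by
  have hz : z = Int.fract z + ⌊z⌋ := (Int.fract_add_floor z).symm
  have hz' : 2 * z = 2 * Int.fract z + 2 * ⌊z⌋ := by linarith
  have h0 := Int.fract_nonneg z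
  have h1 := Int.fract_lt_one z
  set y := Int.fract z
  have hexp : ∀ q : ℤ, Complex.exp (2 * Real.pi * Complex.I * q * z) =
      Complex.exp (2 * Real.pi * Complex.I * q * y) := by
    intro q
    rw [← exp_add_int q ⌊z⌋ y, ← hz]
  simp only [hexp]
  rcases le_or_gt y (1 / 2) with h | h
  · have hn : ‖(z : UnitAddCircle)‖ = y := by
      rw [norm_coe_eq_distLine (j := 2 * ⌊z⌋) (by push_cast; linarith) (by push_cast; linarith),
        distLine, if_pos (even_two_mul _)]
      push_cast; linarith
    rw [triWave, hn]
    exact hasSum_triWave_of_le_half h0 h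
  · have hn : ‖(z : UnitAddCircle)‖ = 1 - y := by
      rw [norm_coe_eq_distLine (j := 2 * ⌊z⌋ + 1) (by push_cast; linarith) (by push_cast; linarith),
        distLine, if_neg (Int.not_even_two_mul_add_one _)]
      push_cast; linarith
    rw [triWave, hn]
    -- The wave changes sign under a shift by half a period, as only odd frequencies occur.
    have H := (hasSum_triWave_of_le_half (y := y - 1 / 2) (by linarith) (by linarith)).neg
    rw [← Complex.ofReal_neg] at H
    rw [show Real.pi ^ 2 / 4 * (1 - 4 * (1 - y)) =
      -(Real.pi ^ 2 / 4 * (1 - 4 * (y - 1 / 2))) by ring]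
    refine H.congr_fun fun q => ?_
    have := exp_add_half q (y - 1 / 2)
    rw [sub_add_cancel] at this
    rw [this]
    unfold triCoeff
    split_ifs <;> simp

lemma hasSum_triCoeff : HasSum triCoeff (Real.pi ^ 2 / 4) := by
  have h := hasSum_triWave 0
  have h0 : triWave 0 = Real.pi ^ 2 / 4 := by simp [triWave]
  rw [h0] at h
  simpa only [Complex.ofReal_zero, mul_zero, Complex.exp_zero, mul_one, Complex.hasSum_ofReal]
    using h

lemma abs_triWave_le (z : ℝ) : |triWave z| ≤ Real.pi ^ 2 / 4 := by
  have h : ‖(z : UnitAddCircle)‖ ≤ 1 / 2 := by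
    simpa using AddCircle.norm_le_half_period (p := (1 : ℝ)) (x := (z : UnitAddCircle)) one_ne_zero
  have h' := norm_nonneg (z : UnitAddCircle)
  rw [triWave, abs_mul, abs_of_nonneg (by positivity : 0 ≤ Real.pi ^ 2 / 4)]
  exact mul_le_of_le_one_right (by positivity) (abs_le.2 ⟨by linarith, by linarith⟩)

/-! ### Choosing summands of mean zero one after the other -/

/-- In a weighted `ℓ²` space, a random summand of mean zero can be chosen so that the squared norm
grows by at most the bound for the square of the summand. -/
lemma exists_tsum_norm_add_sq_le {ι S : Type*} [Countable ι] [MeasurableSpace S] (μ : Measure S)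
    [IsProbabilityMeasure μ] {W : ι → ℝ} (hW : ∀ l, 0 ≤ W l) {y : ι → ℂ}
    (hy : Summable fun l => W l * ‖y l‖ ^ 2) {x : S → ι → ℂ} {X : ι → ℝ}
    (hxm : ∀ l, Measurable fun s => x s l) (hxX : ∀ s l, ‖x s l‖ ≤ X l)
    (hX : Summable fun l => W l * X l ^ 2) (h0 : ∀ l, ∫ s, x s l ∂μ = 0) :
    ∃ s, (Summable fun l => W l * ‖y l + x s l‖ ^ 2) ∧
      ∑' l, W l * ‖y l + x s l‖ ^ 2 ≤ ∑' l, W l * ‖y l‖ ^ 2 + ∑' l, W l * X l ^ 2 := by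
  have hnn : ∀ s l, 0 ≤ W l * ‖y l + x s l‖ ^ 2 := fun s l => mul_nonneg (hW l) (sq_nonneg _)
  have hsum : ∀ s, Summable fun l => W l * ‖y l + x s l‖ ^ 2 := by
    intro s
    refine Summable.of_nonneg_of_le (hnn s) (fun l => ?_) ((hy.add hX).mul_left 2)
    have h1 : ‖y l + x s l‖ ≤ ‖y l‖ + X l := (norm_add_le _ _).trans (by gcongr; exact hxX s l)
    have h2 : ‖y l + x s l‖ ^ 2 ≤ 2 * (‖y l‖ ^ 2 + X l ^ 2) :=
      (pow_le_pow_left₀ (norm_nonneg _) h1 2).trans (by nlinarith [sq_nonneg (‖y l‖ - X l)])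
    calc W l * ‖y l + x s l‖ ^ 2 ≤ W l * (2 * (‖y l‖ ^ 2 + X l ^ 2)) :=
          mul_le_mul_of_nonneg_left h2 (hW l)
      _ = _ := by ring
  have hxi : ∀ l, Integrable (fun s => x s l) μ := fun l =>
    Integrable.of_bound (hxm l).aestronglyMeasurable (X l) (Eventually.of_forall fun s => hxX s l)
  have hxi2 : ∀ l, Integrable (fun s => ‖x s l‖ ^ 2) μ := fun l =>
    Integrable.of_bound ((hxm l).norm.pow_const 2).aestronglyMeasurable (X l ^ 2)
      (Eventually.of_forall fun s => by
        rw [Real.norm_of_nonneg (sq_nonneg _)]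
        exact pow_le_pow_left₀ (norm_nonneg _) (hxX s l) 2)
  have hexp : ∀ l, (fun s => W l * ‖y l + x s l‖ ^ 2) =
      fun s => W l * (‖y l‖ ^ 2 + 2 * inner ℝ (y l) (x s l) + ‖x s l‖ ^ 2) := by
    intro l; funext s; rw [norm_add_sq_real]
  have hin : ∀ l, Integrable (fun s => inner ℝ (y l) (x s l)) μ := fun l =>
    (hxi l).const_inner _
  have hFi : ∀ l, Integrable (fun s => W l * ‖y l + x s l‖ ^ 2) μ := by
    intro l
    rw [hexp]
    exact (((integrable_const _).add ((hin l).const_mul 2)).add (hxi2 l)).const_mul _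
  have hFle : ∀ l, ∫ s, W l * ‖y l + x s l‖ ^ 2 ∂μ ≤ W l * ‖y l‖ ^ 2 + W l * X l ^ 2 := by
    intro l
    have hi : Integrable (fun s => ‖y l‖ ^ 2 + 2 * inner ℝ (y l) (x s l)) μ :=
      (integrable_const _).add ((hin l).const_mul 2)
    -- The cross term is the inner product of `y l` with the mean of `x s l`, which is zero.
    rw [hexp, integral_const_mul, integral_add hi (hxi2 l),
      integral_add (integrable_const _) ((hin l).const_mul 2), integral_const_mul,
      integral_inner (hxi l), h0 l, inner_zero_right, ← mul_add]
    refine mul_le_mul_of_nonneg_left ?_ (hW l)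
    have : ∫ s, ‖x s l‖ ^ 2 ∂μ ≤ ∫ _, X l ^ 2 ∂μ :=
      integral_mono (hxi2 l) (integrable_const _)
        fun s => pow_le_pow_left₀ (norm_nonneg _) (hxX s l) 2
    simp only [integral_const, probReal_univ, one_smul] at this ⊢
    linarith
  have hFm : ∀ l, Measurable fun s => ENNReal.ofReal (W l * ‖y l + x s l‖ ^ 2) := fun l =>
    ((((hxm l).const_add _).norm.pow_const 2).const_mul _).ennreal_ofReal
  -- Some `s` does no worse than the average. In `ENNReal` the sum and the integral can be exchanged
  -- without a summability condition.
  obtain ⟨s, hs⟩ := exists_le_lintegral (μ := μ)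
    (f := fun s => ∑' l, ENNReal.ofReal (W l * ‖y l + x s l‖ ^ 2))
    (Measurable.tsum hFm).aemeasurable
  refine ⟨s, hsum s, ?_⟩
  rw [← hy.tsum_add hX]
  have hnn' : ∀ l, 0 ≤ W l * ‖y l‖ ^ 2 + W l * X l ^ 2 := fun l =>
    add_nonneg (mul_nonneg (hW l) (sq_nonneg _)) (mul_nonneg (hW l) (sq_nonneg _))
  refine (ENNReal.ofReal_le_ofReal_iff (tsum_nonneg hnn')).1 ?_
  rw [ENNReal.ofReal_tsum_of_nonneg (hnn s) (hsum s),
    ENNReal.ofReal_tsum_of_nonneg hnn' (hy.add hX)]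
  refine hs.trans ?_
  rw [lintegral_tsum fun l => (hFm l).aemeasurable]
  refine ENNReal.tsum_le_tsum fun l => ?_
  rw [← ofReal_integral_eq_lintegral_ofReal (hFi l) (Eventually.of_forall fun s => hnn s l)]
  exact ENNReal.ofReal_le_ofReal (hFle l)

/-- Each choice is made with the previous ones frozen into `y`, so variances add up without any
product measure or independence. -/
lemma exists_tsum_norm_add_sum_sq_le {ι S κ : Type*} [Countable ι] [MeasurableSpace S]
    [Nonempty S] (μ : κ → Measure S) [∀ j, IsProbabilityMeasure (μ j)] {W : ι → ℝ}
    (hW : ∀ l, 0 ≤ W l) {y : ι → ℂ} (hy : Summable fun l => W l * ‖y l‖ ^ 2)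
    {x : κ → S → ι → ℂ} {X : κ → ι → ℝ}
    (hxm : ∀ j l, Measurable fun s => x j s l) (hxX : ∀ j s l, ‖x j s l‖ ≤ X j l)
    (hX : ∀ j, Summable fun l => W l * X j l ^ 2) (h0 : ∀ j l, ∫ s, x j s l ∂(μ j) = 0)
    (J : Finset κ) :
    ∃ s : κ → S, (Summable fun l => W l * ‖y l + ∑ j ∈ J, x j (s j) l‖ ^ 2) ∧
      ∑' l, W l * ‖y l + ∑ j ∈ J, x j (s j) l‖ ^ 2 ≤
        ∑' l, W l * ‖y l‖ ^ 2 + ∑ j ∈ J, ∑' l, W l * X j l ^ 2 := by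
  classical
  induction J using Finset.induction_on with
  | empty => exact ⟨fun _ => Classical.arbitrary S, by simpa using hy, by simp⟩
  | insert a J ha ih =>
    obtain ⟨s, hs, hle⟩ := ih
    obtain ⟨t, ht, htle⟩ := exists_tsum_norm_add_sq_le (μ a) hW hs (hxm a) (hxX a) (hX a) (h0 a)
    refine ⟨Function.update s a t, ?_⟩
    have e : ∀ l, y l + ∑ j ∈ insert a J, x j (Function.update s a t j) l =
        y l + ∑ j ∈ J, x j (s j) l + x a t l := by
      intro l
      rw [Finset.sum_insert ha, Function.update_self,
        Finset.sum_congr rfl (g := fun j => x j (s j) l)]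
      · ring
      · intro j hj
        rw [Function.update_of_ne (ne_of_mem_of_not_mem hj ha)]
    simp only [e]
    refine ⟨ht, htle.trans ?_⟩
    rw [Finset.sum_insert ha]
    linarith

/-! ### Random phases -/

/-- The probability measure on `(-1/2, 1/2]` with density `1 + Re (u exp (2 π i s))`. -/
def phaseMeasure (u : ℂ) : Measure ℝ :=
  (volume.restrict (Set.Ioc (-(1 / 2) : ℝ) (1 / 2))).withDensity fun s =>
    ENNReal.ofReal (1 + (u * Complex.exp (2 * Real.pi * Complex.I * (1 : ℤ) * s)).re)

lemma norm_exp_two_pi_int (n : ℤ) (s : ℝ) :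
    ‖Complex.exp (2 * Real.pi * Complex.I * n * s)‖ = 1 := by
  have : 2 * Real.pi * Complex.I * n * s = ((2 * Real.pi * n * s : ℝ) : ℂ) * Complex.I := by
    push_cast; ring
  rw [this, Complex.norm_exp_ofReal_mul_I]

lemma phase_density_nonneg {u : ℂ} (hu : ‖u‖ ≤ 1) (s : ℝ) :
    0 ≤ 1 + (u * Complex.exp (2 * Real.pi * Complex.I * (1 : ℤ) * s)).re := by
  have h := Complex.abs_re_le_norm (u * Complex.exp (2 * Real.pi * Complex.I * (1 : ℤ) * s))
  rw [norm_mul, norm_exp_two_pi_int, mul_one] at h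
  linarith [(abs_le.1 h).1]

/-- The density is a combination of the exponentials of frequency `0`, `1` and `-1`, and
orthogonality leaves only these. The condition `‖u‖ ≤ 1` keeps it nonnegative, so that
`ENNReal.ofReal` does not truncate. -/
lemma integral_phaseMeasure {u : ℂ} (hu : ‖u‖ ≤ 1) (n : ℤ) :
    ∫ s, Complex.exp (2 * Real.pi * Complex.I * n * s) ∂(phaseMeasure u) =
      (if n = 0 then 1 else 0) + (if n = -1 then u / 2 else 0) +
        (if n = 1 then (starRingEnd ℂ) u / 2 else 0) := by
  rw [phaseMeasure, integral_withDensity_eq_integral_toReal_smul (by fun_prop)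
    (Eventually.of_forall fun _ => ENNReal.ofReal_lt_top),
    ← intervalIntegral.integral_of_le (by norm_num : (-(1 / 2) : ℝ) ≤ 1 / 2)]
  have e : ∀ s : ℝ, (ENNReal.ofReal
      (1 + (u * Complex.exp (2 * Real.pi * Complex.I * (1 : ℤ) * s)).re)).toReal •
      Complex.exp (2 * Real.pi * Complex.I * n * s) =
      Complex.exp (2 * Real.pi * Complex.I * n * s) +
      u / 2 * Complex.exp (2 * Real.pi * Complex.I * (n + 1 : ℤ) * s) +
      (starRingEnd ℂ) u / 2 * Complex.exp (2 * Real.pi * Complex.I * (n - 1 : ℤ) * s) := by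
    intro s
    rw [ENNReal.toReal_ofReal (phase_density_nonneg hu s), Complex.real_smul, Complex.ofReal_add,
      Complex.re_eq_add_conj, map_mul, ← Complex.exp_conj]
    have h1 : 2 * Real.pi * Complex.I * (n + 1 : ℤ) * s =
      2 * Real.pi * Complex.I * n * s + 2 * Real.pi * Complex.I * (1 : ℤ) * s := by push_cast; ring
    have h2 : 2 * Real.pi * Complex.I * (n - 1 : ℤ) * s = 2 * Real.pi * Complex.I * n * s +
        (starRingEnd ℂ) (2 * Real.pi * Complex.I * (1 : ℤ) * s) := by
      simp [Complex.conj_ofReal, Complex.conj_ofNat]; ring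
    rw [h1, h2, Complex.exp_add, Complex.exp_add]
    push_cast
    ring
  simp only [e]
  have hc : ∀ n : ℤ, Continuous fun s : ℝ => Complex.exp (2 * Real.pi * Complex.I * n * s) :=
    fun n => by fun_prop
  rw [intervalIntegral.integral_add, intervalIntegral.integral_add,
    intervalIntegral.integral_const_mul, intervalIntegral.integral_const_mul, integral_exp,
    integral_exp, integral_exp]
  · simp only [mul_ite, mul_one, mul_zero, eq_neg_iff_add_eq_zero, sub_eq_zero]
  · exact (hc n).intervalIntegrable _ _
  · exact ((hc _).const_smul (u / 2)).intervalIntegrable _ _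
  · exact ((hc n).add ((hc _).const_smul (u / 2))).intervalIntegrable _ _
  · exact ((hc _).const_smul ((starRingEnd ℂ) u / 2)).intervalIntegrable _ _

lemma isProbabilityMeasure_phaseMeasure {u : ℂ} (hu : ‖u‖ ≤ 1) :
    IsProbabilityMeasure (phaseMeasure u) := by
  have h := integral_phaseMeasure hu 0
  simp only [Int.cast_zero, mul_zero, zero_mul, Complex.exp_zero, integral_const] at h
  norm_num at h
  rw [Measure.real, ENNReal.toReal_eq_one_iff] at h
  exact ⟨h⟩

section

/-! ### Triangle waves in the direction of a multi-index -/

/-- The weight of the frequency `k` in the norms of order `1` and `2`. -/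
def weight (k : ℕ →₀ ℤ) : ℝ := 1 + (2 * Real.pi) ^ 2 * l1 k ^ 2

lemma weight_pos (k : ℕ →₀ ℤ) : 0 < weight k := by unfold weight; positivity

lemma one_le_weight (k : ℕ →₀ ℤ) : 1 ≤ weight k := by
  unfold weight; linarith [show 0 ≤ (2 * Real.pi) ^ 2 * l1 k ^ 2 by positivity]

lemma l1_eq_sum {k : ℕ →₀ ℤ} {s : Finset ℕ} (h : k.support ⊆ s) :
    l1 k = ∑ i ∈ s, |(k i : ℝ)| :=
  Finset.sum_subset h fun i _ hi => by simp [Finsupp.notMem_support_iff.1 hi]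

lemma l1_smul (q : ℤ) (k : ℕ →₀ ℤ) : l1 (q • k) = |(q : ℝ)| * l1 k := by
  rw [l1_eq_sum (Finsupp.support_smul (b := q) (g := k)), l1, Finset.mul_sum]
  exact Finset.sum_congr rfl fun i _ => by simp [abs_mul]

/-- The sum `∑ kᵢ bᵢ`. -/
def pairing (k : ℕ →₀ ℤ) (b : ℕ → ℝ) : ℝ := ∑ i ∈ k.support, (k i : ℝ) * b i

lemma pairing_eq_sum {k : ℕ →₀ ℤ} {s : Finset ℕ} (h : k.support ⊆ s) (b : ℕ → ℝ) :
    pairing k b = ∑ i ∈ s, (k i : ℝ) * b i :=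
  Finset.sum_subset h fun i _ hi => by simp [Finsupp.notMem_support_iff.1 hi]

lemma pairing_smul (q : ℤ) (k : ℕ →₀ ℤ) (b : ℕ → ℝ) : pairing (q • k) b = q * pairing k b := by
  rw [pairing_eq_sum (Finsupp.support_smul (b := q) (g := k)), pairing, Finset.mul_sum]
  exact Finset.sum_congr rfl fun i _ => by simp [mul_assoc]

lemma expSum_eq_pairing (k : ℕ →₀ ℤ) (b : ℕ → ℝ) :
    expSum k b = Complex.exp (2 * Real.pi * Complex.I * pairing k b) := by
  rw [expSum, pairing]
  push_cast
  rw [Finset.mul_sum]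
  congr 1
  exact Finset.sum_congr rfl fun i _ => by ring

lemma zsmul_injective {k : ℕ →₀ ℤ} (hk : k ≠ 0) : Function.Injective fun q : ℤ => q • k :=
  smul_left_injective ℤ hk

/-- The Fourier coefficients of the functional `triWave (∑ kᵢ bᵢ - s)`. -/
def waveCoeff (k : ℕ →₀ ℤ) (s : ℝ) : (ℕ →₀ ℤ) → ℂ :=
  Function.extend (fun q : ℤ => q • k)
    (fun q => (triCoeff q : ℂ) * Complex.exp (2 * Real.pi * Complex.I * (-q : ℤ) * s)) 0

/-- The Fourier coefficients of the functional `Re (u exp (2 π i ∑ kᵢ bᵢ))`. -/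
def cosCoeff (k : ℕ →₀ ℤ) (u : ℂ) (l : ℕ →₀ ℤ) : ℂ :=
  (if l = k then u / 2 else 0) + (if l = -k then (starRingEnd ℂ) u / 2 else 0)

/-- A bound for the coefficients of `triWave` in direction `k`. -/
def waveBound (k : ℕ →₀ ℤ) : (ℕ →₀ ℤ) → ℝ :=
  Function.extend (fun q : ℤ => q • k) (fun q => 2 * triCoeff q) 0

variable {k : ℕ →₀ ℤ}

lemma waveCoeff_zsmul (hk : k ≠ 0) (s : ℝ) (q : ℤ) : waveCoeff k s (q • k) =
    (triCoeff q : ℂ) * Complex.exp (2 * Real.pi * Complex.I * (-q : ℤ) * s) :=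
  (zsmul_injective hk).extend_apply _ _ q

lemma waveCoeff_of_notMem {l : ℕ →₀ ℤ} (s : ℝ) (hl : l ∉ Set.range fun q : ℤ => q • k) :
    waveCoeff k s l = 0 := by
  rw [waveCoeff, Function.extend_apply' _ _ _ hl]; rfl

lemma support_subset_of_waveCoeff_ne_zero {l : ℕ →₀ ℤ} {s : ℝ} (h : waveCoeff k s l ≠ 0) :
    l.support ⊆ k.support := by
  by_contra hl
  refine h (waveCoeff_of_notMem s ?_)
  rintro ⟨q, rfl⟩
  exact hl Finsupp.support_smul

lemma hasSum_waveCoeff (hk : k ≠ 0) (s : ℝ) (b : ℕ → ℝ) :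
    HasSum (fun l => waveCoeff k s l * expSum l b) (triWave (pairing k b - s) : ℂ) := by
  rw [← (zsmul_injective hk).hasSum_iff]
  · refine (hasSum_triWave (pairing k b - s)).congr_fun fun q => ?_
    simp only [Function.comp]
    rw [waveCoeff_zsmul hk, expSum_eq_pairing, pairing_smul, mul_assoc, ← Complex.exp_add]
    congr 2
    push_cast
    ring
  · intro l hl
    rw [waveCoeff_of_notMem s hl, zero_mul]

lemma summable_norm_waveCoeff (hk : k ≠ 0) (s : ℝ) : Summable fun l => ‖waveCoeff k s l‖ := by
  have := (hasSum_waveCoeff hk s 0).summable.norm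
  simpa [norm_expSum] using this

lemma triCoeff_one : triCoeff 1 = 1 := by simp [triCoeff]

lemma triCoeff_neg_one : triCoeff (-1) = 1 := by simp [triCoeff]

lemma cosCoeff_zsmul (hk : k ≠ 0) (u : ℂ) (q : ℤ) : cosCoeff k u (q • k) =
    (if q = 1 then u / 2 else 0) + (if q = -1 then (starRingEnd ℂ) u / 2 else 0) := by
  have h1 : q • k = k ↔ q = 1 := by
    constructor
    · intro h
      exact zsmul_injective hk (by simpa using h)
    · rintro rfl; simp
  have h2 : q • k = -k ↔ q = -1 := by
    constructor
    · intro h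
      exact zsmul_injective hk (by simpa using h)
    · rintro rfl; simp
  rw [cosCoeff]
  simp only [h1, h2]

lemma cosCoeff_of_notMem {l : ℕ →₀ ℤ} (u : ℂ) (hl : l ∉ Set.range fun q : ℤ => q • k) :
    cosCoeff k u l = 0 := by
  rw [cosCoeff, if_neg, if_neg, add_zero]
  · rintro rfl; exact hl ⟨-1, by simp⟩
  · rintro rfl; exact hl ⟨1, by simp⟩

/-- The trigonometric part lives at `q = ±1`, where its size `‖u‖ / 2` is below `triCoeff q = 1`.
The bound does not depend on the phase, as the selection argument requires. -/
lemma norm_waveCoeff_sub_cosCoeff_le (hk : k ≠ 0) {u : ℂ} (hu : ‖u‖ ≤ 1) (s : ℝ) (l : ℕ →₀ ℤ) :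
    ‖waveCoeff k s l - cosCoeff k u l‖ ≤ waveBound k l := by
  by_cases hl : l ∈ Set.range fun q : ℤ => q • k
  · obtain ⟨q, rfl⟩ := hl
    simp only
    rw [waveBound, (zsmul_injective hk).extend_apply, waveCoeff_zsmul hk, cosCoeff_zsmul hk]
    refine (norm_sub_le _ _).trans ?_
    rw [norm_mul, norm_exp_two_pi_int, mul_one, Complex.norm_real,
      Real.norm_of_nonneg (triCoeff_nonneg q), two_mul]
    gcongr
    by_cases h1 : q = 1
    · subst h1
      simp [triCoeff_one]; linarith
    · by_cases h2 : q = -1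
      · subst h2
        norm_num [triCoeff_neg_one]; linarith
      · simpa [h1, h2] using triCoeff_nonneg q
  · rw [waveCoeff_of_notMem s hl, cosCoeff_of_notMem u hl, waveBound,
      Function.extend_apply' _ _ _ hl]
    simp

lemma measurable_waveCoeff (hk : k ≠ 0) (l : ℕ →₀ ℤ) : Measurable fun s => waveCoeff k s l := by
  by_cases hl : l ∈ Set.range fun q : ℤ => q • k
  · obtain ⟨q, rfl⟩ := hl
    simp only [waveCoeff_zsmul hk]
    fun_prop
  · simp only [waveCoeff_of_notMem _ hl]
    fun_prop

/-- Averaged over the phase, the triangle wave is a trigonometric function. -/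
lemma integral_waveCoeff_sub_cosCoeff (hk : k ≠ 0) {u : ℂ} (hu : ‖u‖ ≤ 1) (l : ℕ →₀ ℤ) :
    ∫ s, (waveCoeff k s l - cosCoeff k u l) ∂(phaseMeasure u) = 0 := by
  have := isProbabilityMeasure_phaseMeasure hu
  by_cases hl : l ∈ Set.range fun q : ℤ => q • k
  · obtain ⟨q, rfl⟩ := hl
    simp only [waveCoeff_zsmul hk, cosCoeff_zsmul hk]
    rw [integral_sub _ (integrable_const _), integral_const_mul, integral_phaseMeasure hu]
    · simp only [neg_eq_zero, neg_inj, integral_const, probReal_univ, one_smul]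
      by_cases h0 : q = 0
      · subst h0; norm_num [triCoeff_zero]
      by_cases h1 : q = 1
      · subst h1; norm_num [triCoeff_one]
      by_cases h2 : q = -1
      · subst h2; norm_num [triCoeff_neg_one]
      have h3 : -q ≠ 1 := fun h => h2 (by omega)
      simp [h0, h1, h2, h3]
    · refine Integrable.of_bound (by fun_prop) (triCoeff q) (Eventually.of_forall fun s => ?_)
      rw [norm_mul, norm_exp_two_pi_int, mul_one, Complex.norm_real,
        Real.norm_of_nonneg (triCoeff_nonneg q)]
  · simp [waveCoeff_of_notMem _ hl, cosCoeff_of_notMem _ hl]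

/-- The weight grows at most by the factor `q²`, which uses up one of the two factors `1 / q²`; the
other remains for summability. -/
lemma weight_mul_triCoeff_sq_le (k : ℕ →₀ ℤ) (q : ℤ) :
    weight (q • k) * (2 * triCoeff q) ^ 2 ≤ 4 * weight k * triCoeff q := by
  unfold triCoeff
  split_ifs with h
  · simp
  · have hq : 1 ≤ (q : ℝ) ^ 2 := by
      have : q ≠ 0 := by rintro rfl; simp at h
      have : 1 ≤ q ^ 2 := by have := sq_pos_of_ne_zero this; omega
      exact_mod_cast this
    have hw : weight (q • k) ≤ q ^ 2 * weight k := by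
      rw [weight, weight, l1_smul, mul_pow |(q : ℝ)|, sq_abs]
      nlinarith
    calc weight (q • k) * (2 * (1 / (q : ℝ) ^ 2)) ^ 2
        ≤ (q ^ 2 * weight k) * (2 * (1 / (q : ℝ) ^ 2)) ^ 2 := by gcongr
      _ = 4 * weight k * (1 / q ^ 2) := by
        field_simp
        ring

lemma summable_waveBound (hk : k ≠ 0) :
    (Summable fun l => weight l * waveBound k l ^ 2) ∧
      ∑' l, weight l * waveBound k l ^ 2 ≤ 10 * weight k := by
  have hz : ∀ l ∉ Set.range fun q : ℤ => q • k, weight l * waveBound k l ^ 2 = 0 := by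
    intro l hl
    rw [waveBound, Function.extend_apply' _ _ _ hl]
    simp
  have he : ∀ q : ℤ, waveBound k (q • k) = 2 * triCoeff q := fun q =>
    (zsmul_injective hk).extend_apply _ _ q
  have hs : Summable fun q : ℤ => weight (q • k) * waveBound k (q • k) ^ 2 := by
    refine Summable.of_nonneg_of_le
      (fun q => mul_nonneg (weight_pos _).le (sq_nonneg _)) (fun q => ?_)
      (hasSum_triCoeff.summable.mul_left (4 * weight k))
    rw [he]
    exact weight_mul_triCoeff_sq_le k q
  refine ⟨((zsmul_injective hk).summable_iff hz).1 hs, ?_⟩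
  rw [← (zsmul_injective hk).tsum_eq (f := fun l => weight l * waveBound k l ^ 2)
    (fun l hl => by_contra fun h => hl (hz l h))]
  refine (hs.tsum_le_tsum (fun q => by rw [he]; exact weight_mul_triCoeff_sq_le k q)
    (hasSum_triCoeff.summable.mul_left (4 * weight k))).trans ?_
  -- The sum is `4 * weight k * (π² / 4)`, and `π² ≤ 10`.
  rw [tsum_mul_left, hasSum_triCoeff.tsum_eq]
  have h10 : Real.pi ^ 2 ≤ 10 := by
    nlinarith [Real.pi_lt_d2, Real.pi_pos]
  nlinarith [weight_pos k]

/-! ### The triangle wave as a ReLU network -/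

lemma l1_eq_natCast (k : ℕ →₀ ℤ) : l1 k = ((∑ i ∈ k.support, (k i).natAbs : ℕ) : ℝ) := by
  rw [l1]
  push_cast
  exact Finset.sum_congr rfl fun i _ => by simp [Nat.cast_natAbs]

lemma abs_pairing_le (k : ℕ →₀ ℤ) {b : ℕ → ℝ} (hb : ∀ i, |b i| ≤ 1 / 2) :
    |pairing k b| ≤ l1 k / 2 := by
  rw [pairing, l1, Finset.sum_div]
  refine (Finset.abs_sum_le_sum_abs _ _).trans (Finset.sum_le_sum fun i _ => ?_)
  rw [abs_mul]
  have := mul_le_mul_of_nonneg_left (hb i) (abs_nonneg (k i : ℝ))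
  linarith

lemma l1_pos (hk : k ≠ 0) : 0 < l1 k := by
  obtain ⟨i, hi⟩ := Finsupp.support_nonempty_iff.2 hk
  refine Finset.sum_pos (fun i hi => ?_) ⟨i, hi⟩
  simpa using hi

lemma support_subset_range_len (k : ℕ →₀ ℤ) : k.support ⊆ Finset.range (len k) := by
  intro i hi
  exact Finset.mem_range.2 (Finset.le_sup (f := fun i => i + 1) hi)

lemma sum_range_len_abs_div (hk : k ≠ 0) :
    ∑ i ∈ Finset.range (len k), |(k i : ℝ) / l1 k| = 1 := by
  simp only [abs_div, abs_of_pos (l1_pos hk)]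
  rw [← Finset.sum_div, ← l1_eq_sum (support_subset_range_len k), div_self (l1_pos hk).ne']

lemma sum_range_len_mul (k : ℕ →₀ ℤ) (b : ℕ → ℝ) :
    ∑ i ∈ Finset.range (len k), (k i : ℝ) / l1 k * b i = pairing k b / l1 k := by
  rw [pairing_eq_sum (support_subset_range_len k), Finset.sum_div]
  exact Finset.sum_congr rfl fun i _ => by ring

lemma pos_mul_max_zero_div {K : ℝ} (hK : 0 < K) (x y : ℝ) :
    max 0 (x - y) = K * max 0 (x / K - y / K) := by
  rw [mul_max_of_nonneg _ _ hK.le, mul_zero, mul_sub, mul_div_cancel₀ _ hK.ne',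
    mul_div_cancel₀ _ hK.ne']

/-- On the cube, the triangle wave in direction `k` is a network with `2 |k|₁ + 1` units whose
weights are normalized in `ℓ¹`. -/
lemma exists_relu_triWave (hk : k ≠ 0) {n : ℕ} (hn : l1 k = n) (s : ℝ) :
    ∃ (c : ℝ) (γ t : Fin (2 * n + 1) → ℝ), |c| ≤ weight k ∧ ∑ j, |γ j| ≤ 4 * weight k ∧
      (∀ j, |t j| ≤ 1) ∧ ∀ b : ℕ → ℝ, (∀ i, |b i| ≤ 1 / 2) →
        triWave (pairing k b - s) = c + ∑ j, γ j * max 0 (pairing k b / l1 k - t j) := by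
  have hn1 : (1 : ℝ) ≤ n := by
    have h := l1_pos hk
    rw [hn] at h
    exact_mod_cast h
  have hn0 : (0 : ℝ) < n := by linarith
  -- The left end of the range of `pairing k b - s`, an interval of length `n`, hence `2 n` kinks.
  set z₀ : ℝ := -(n / 2) - s with hz₀
  set p : ℤ := ⌊2 * z₀⌋ with hp
  have hpi : 0 < Real.pi ^ 2 := by positivity
  have hw : weight k = 1 + 4 * (Real.pi ^ 2 * (n : ℝ) ^ 2) := by rw [weight, hn]; ring
  have hnn : (n : ℝ) ≤ n ^ 2 := by nlinarith
  have hpn : Real.pi ^ 2 * n ≤ Real.pi ^ 2 * (n : ℝ) ^ 2 := by gcongr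
  have hpn1 : Real.pi ^ 2 * 1 ≤ Real.pi ^ 2 * n := by gcongr
  -- The first unit has threshold `-1/2`, is active on the whole cube and carries the initial slope;
  -- the others sit at the kinks. The factor `n` compensates the division of the inner weights by
  -- `l1 k = n`.
  refine ⟨triWave z₀, Fin.cons (-(Real.pi ^ 2 * n * distSlope p))
    (fun i => -(2 * Real.pi ^ 2 * n * distSlope (p + (i : ℕ) + 1))),
    Fin.cons (-(1 / 2)) (fun i => ((p + (i : ℕ) + 1) / 2 + s) / n), ?_, ?_, ?_, ?_⟩
  · refine (abs_triWave_le z₀).trans ?_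
    rw [hw]
    linarith
  · rw [Fin.sum_univ_succ]
    simp only [Fin.cons_zero, Fin.cons_succ, abs_neg, abs_mul, abs_distSlope, mul_one,
      Finset.sum_const, Finset.card_univ, Fintype.card_fin, nsmul_eq_mul]
    rw [abs_of_pos hpi, Nat.abs_cast, Nat.abs_ofNat, hw]
    push_cast
    nlinarith
  · intro j
    refine Fin.cases ?_ (fun i => ?_) j
    · norm_num [Fin.cons_zero]
    -- From `p ≤ 2 z₀ < p + 1` and `i + 1 ≤ 2 n`, the kinks shifted by `s` lie in `(-n/2, n/2]`.
    · rw [Fin.cons_succ, abs_le, le_div_iff₀ hn0, div_le_iff₀ hn0]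
      have h1 := Int.floor_le (2 * z₀)
      have h2 := Int.lt_floor_add_one (2 * z₀)
      rw [← hp] at h1 h2
      have h3 : ((i : ℕ) : ℝ) + 1 ≤ 2 * n := by
        have : (i : ℕ) + 1 ≤ 2 * n := i.2
        exact_mod_cast this
      have h4 : (0 : ℝ) ≤ (i : ℕ) := Nat.cast_nonneg _
      constructor <;> linarith
  · intro b hb
    have hpb := abs_le.1 (abs_pairing_le k hb)
    rw [hn] at hpb ⊢
    have key := norm_coe_eq_sum_relu z₀ (pairing k b - s) (2 * n) (by linarith)
      (by push_cast; linarith)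
    rw [Fin.sum_univ_succ, triWave, triWave, key, ← hp, Finset.sum_range]
    simp only [Fin.cons_zero, Fin.cons_succ]
    have e0 : max 0 (pairing k b - s - z₀) = n * max 0 (pairing k b / n - -(1 / 2)) := by
      rw [show pairing k b - s - z₀ = pairing k b - (-(1 / 2)) * n by rw [hz₀]; ring,
        pos_mul_max_zero_div hn0, mul_div_cancel_right₀ _ hn0.ne']
    have e1 : ∀ i : ℕ, max 0 (pairing k b - s - (p + i + 1) / 2) =
        n * max 0 (pairing k b / n - ((p + i + 1) / 2 + s) / n) := by
      intro i
      rw [← pos_mul_max_zero_div hn0]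
      congr 1; ring
    simp only [e0, e1]
    have e2 : ∀ M : ℕ → ℝ,
        ∑ i : Fin (2 * n), -(2 * Real.pi ^ 2 * n * distSlope (p + (i : ℕ) + 1)) * M i =
        -Real.pi ^ 2 * ∑ i : Fin (2 * n), 2 * distSlope (p + (i : ℕ) + 1) * (n * M i) := by
      intro M
      rw [Finset.mul_sum]
      exact Finset.sum_congr rfl fun i _ => by ring
    rw [e2 fun i => max 0 (pairing k b / n - ((p + i + 1) / 2 + s) / n)]
    ring

end

section

/-! ### Subtracting a functional of finitely many coefficients -/

/-- The extension by zero of a family of coefficients indexed by a finite set. -/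
def extendCoef {D : Finset ℕ} (b : D → ℝ) (i : ℕ) : ℝ := if h : i ∈ D then b ⟨i, h⟩ else 0

lemma expSum_congr {l : ℕ →₀ ℤ} {b b' : ℕ → ℝ} (h : ∀ i ∈ l.support, b i = b' i) :
    expSum l b = expSum l b' := by
  rw [expSum, expSum, Finset.sum_congr rfl]
  intro i hi
  rw [h i hi]

lemma expSum_extendCoef {D : Finset ℕ} {l : ℕ →₀ ℤ} (hl : l.support ⊆ D) (b : D → ℝ) :
    expSum l (extendCoef b) = ∏ i : D, Complex.exp (2 * Real.pi * Complex.I * (l i : ℂ) * b i) := by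
  rw [expSum, ← Complex.exp_sum, Finset.sum_subset hl, ← Finset.sum_coe_sort]
  · congr 1
    refine Finset.sum_congr rfl fun i _ => ?_
    rw [extendCoef, dif_pos i.2]
  · intro i _ hi
    simp [Finsupp.notMem_support_iff.1 hi]

lemma restrict_cube (D : Finset ℕ) : (volume : Measure (D → ℝ)).restrict (cube D) =
    Measure.pi fun _ : D => volume.restrict (Set.Ioo (-(1 / 2) : ℝ) (1 / 2)) := by
  rw [cube, volume_pi, Measure.restrict_pi_pi]

lemma isFiniteMeasure_restrict_cube (D : Finset ℕ) :
    IsFiniteMeasure ((volume : Measure (D → ℝ)).restrict (cube D)) := by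
  rw [restrict_cube]; infer_instance

lemma integral_Ioo_exp (n : ℤ) :
    ∫ x in Set.Ioo (-(1 / 2) : ℝ) (1 / 2),
      Complex.exp (2 * Real.pi * Complex.I * (n : ℂ) * (x : ℂ)) = if n = 0 then 1 else 0 := by
  rw [← integral_Ioc_eq_integral_Ioo,
    ← intervalIntegral.integral_of_le (by norm_num : (-(1 / 2) : ℝ) ≤ 1 / 2), integral_exp]

/-- The integral factors over the coordinates in `D`. Both supports lie in `D`, so distinct indices
differ at some coordinate there, whose factor is zero. -/
lemma integral_cube_exp {D : Finset ℕ} {l k : ℕ →₀ ℤ} (hl : l.support ⊆ D) (hk : k.support ⊆ D) :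
    ∫ b in cube D, expSum l (extendCoef b) *
      ∏ i : D, Complex.exp (-(2 * Real.pi * Complex.I * (k i : ℂ) * (b i : ℂ))) =
      if l = k then 1 else 0 := by
  have e : ∀ b : D → ℝ, expSum l (extendCoef b) *
      ∏ i : D, Complex.exp (-(2 * Real.pi * Complex.I * (k i : ℂ) * (b i : ℂ))) =
      ∏ i : D, Complex.exp (2 * Real.pi * Complex.I * ((l i - k i : ℤ) : ℂ) * (b i : ℂ)) := by
    intro b
    rw [expSum_extendCoef hl, ← Finset.prod_mul_distrib]
    refine Finset.prod_congr rfl fun i _ => ?_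
    rw [← Complex.exp_add]
    congr 1
    push_cast; ring
  simp only [e]
  rw [restrict_cube, integral_fintype_prod_eq_prod
    (fun (i : D) (x : ℝ) => Complex.exp (2 * Real.pi * Complex.I * ((l i - k i : ℤ) : ℂ) * x))]
  simp only [integral_Ioo_exp, sub_eq_zero]
  by_cases h : l = k
  · simp [h]
  · rw [if_neg h]
    obtain ⟨i, hi⟩ : ∃ i, l i ≠ k i := by
      by_contra! H
      exact h (Finsupp.ext H)
    have hiD : i ∈ D := by
      by_contra hiD
      rw [Finsupp.notMem_support_iff.1 fun H => hiD (hl H),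
        Finsupp.notMem_support_iff.1 fun H => hiD (hk H)] at hi
      exact hi rfl
    exact Finset.prod_eq_zero (Finset.mem_univ ⟨i, hiD⟩) (if_neg hi)

lemma continuous_expSum_extendCoef {D : Finset ℕ} (l : ℕ →₀ ℤ) :
    Continuous fun b : D → ℝ => expSum l (extendCoef b) := by
  have h : ∀ i, Continuous fun b : D → ℝ => extendCoef b i := by
    intro i
    unfold extendCoef
    by_cases hi : i ∈ D
    · simp only [hi, dif_pos]; fun_prop
    · simp only [hi, dif_neg, not_false_iff]; fun_prop
  unfold expSum
  fun_prop

/-- The Fourier coefficients of an absolutely convergent Fourier series in the coefficients with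
index in `D`. -/
lemma integral_cube_mul_exp {D : Finset ℕ} {g : (ℕ →₀ ℤ) → ℂ} (hg : Summable fun l => ‖g l‖)
    (hD : ∀ l, g l ≠ 0 → l.support ⊆ D) {k : ℕ →₀ ℤ} (hk : k.support ⊆ D) :
    ∫ b in cube D, (∑' l, g l * expSum l (extendCoef b)) *
      ∏ i : D, Complex.exp (-(2 * Real.pi * Complex.I * (k i : ℂ) * (b i : ℂ))) = g k := by
  have := isFiniteMeasure_restrict_cube D
  let P : (D → ℝ) → ℂ := fun b =>
    ∏ i : D, Complex.exp (-(2 * Real.pi * Complex.I * (k i : ℂ) * (b i : ℂ)))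
  have hP : Continuous P := by fun_prop
  have hPn : ∀ b, ‖P b‖ = 1 := by
    intro b
    simp only [P, norm_prod]
    refine Finset.prod_eq_one fun i _ => ?_
    have e : -(2 * Real.pi * Complex.I * (k i : ℂ) * (b i : ℂ)) =
      2 * Real.pi * Complex.I * (-k i : ℤ) * (b i : ℂ) := by push_cast; ring
    rw [e, norm_exp_two_pi_int]
  have hn : ∀ l b, ‖g l * expSum l (extendCoef b) * P b‖ = ‖g l‖ := by
    intro l b
    rw [norm_mul, norm_mul, norm_expSum, hPn, mul_one, mul_one]
  have hint := hasSum_integral_of_summable_integral_norm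
    (μ := (volume : Measure (D → ℝ)).restrict (cube D))
    (F := fun l b => g l * expSum l (extendCoef b) * P b)
    (fun l => Integrable.of_bound
      (((continuous_expSum_extendCoef l).const_smul (g l)).mul hP).aestronglyMeasurable ‖g l‖
      (Eventually.of_forall fun b => (hn l b).le))
    (by simpa only [hn, integral_const, smul_eq_mul] using hg.mul_left _)
  have hval : ∀ l, ∫ b in cube D, g l * expSum l (extendCoef b) * P b =
      if l = k then g k else 0 := by
    intro l
    by_cases hl : g l = 0
    · by_cases h : l = k
      · subst h; simp [hl]
      · simp [hl, h]
    · simp only [mul_assoc]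
      rw [integral_const_mul, integral_cube_exp (hD l hl) hk]
      by_cases h : l = k
      · simp [h]
      · simp [h]
  simp only [hval, tsum_mul_right] at hint
  exact hint.unique (hasSum_ite_eq k (g k))

variable {𝕜 Ω : Type*} [RCLike 𝕜] [NormedAddCommGroup Ω] [NormedSpace 𝕜 Ω]

lemma coord_sum_smul (Φ : SchauderBasis 𝕜 Ω) {D : Finset ℕ} (b : D → ℝ) (i : ℕ) :
    Φ.coord i (∑ j : D, (b j : 𝕜) • Φ.basis j) = (extendCoef b i : 𝕜) := by
  simp only [map_sum, map_smul, Φ.ortho, Pi.single_apply, smul_eq_mul, mul_ite, mul_one, mul_zero]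
  unfold extendCoef
  by_cases hi : i ∈ D
  · rw [dif_pos hi, Finset.sum_eq_single ⟨i, hi⟩]
    · simp
    · intro j _ hj
      exact if_neg fun h => hj (Subtype.ext h.symm)
    · simp
  · rw [dif_neg hi, Finset.sum_eq_zero]
    · simp
    · intro j _
      exact if_neg fun h : i = j => hi (h ▸ j.2)

lemma coef_mem_Ioo (Φ : SchauderBasis 𝕜 Ω) (v : LBound Φ) (i : ℕ) :
    coef Φ v i ∈ Set.Ioo (-(1 / 2) : ℝ) (1 / 2) := by
  obtain ⟨x, hx, h⟩ := v.2 i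
  rw [coef, h, RCLike.ofReal_re]
  exact hx

/-- Subtracting a functional of finitely many coefficients with an absolutely convergent Fourier
series. -/
lemma HasFourierSeries.sub_finite {Φ : SchauderBasis 𝕜 Ω} {r : ℕ} {f : LBound Φ → ℝ}
    {a : (ℕ →₀ ℤ) → ℂ} (h : HasFourierSeries Φ r f a) {N : (ℕ → ℝ) → ℝ} {D : Finset ℕ}
    {g : (ℕ →₀ ℤ) → ℂ} (hg : Summable fun l => ‖g l‖) (hD : ∀ l, g l ≠ 0 → l.support ⊆ D)
    (hN : ∀ b, HasSum (fun l => g l * expSum l b) (N b : ℂ)) :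
    HasFourierSeries Φ 0 (fun v => f v - N (coef Φ v)) fun l => a l - g l := by
  have hNc : ∀ b b' : ℕ → ℝ, (∀ i ∈ D, b i = b' i) → N b = N b' := by
    intro b b' hb
    have e : (fun l => g l * expSum l b) = fun l => g l * expSum l b' := by
      funext l
      by_cases hl : g l = 0
      · simp [hl]
      · rw [expSum_congr fun i hi => hb i (hD l hl hi)]
    exact_mod_cast (hN b).unique (e ▸ hN b')
  obtain ⟨⟨d, hd⟩, hs⟩ := h
  refine ⟨?_, fun v => ?_⟩
  · let F₀ : Ω → ℝ := fun w => -N fun i => RCLike.re (Φ.coord i w)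
    have hF₀ : ∀ b : D → ℝ, onSpan Φ D F₀ b = -N (extendCoef b) := by
      intro b
      simp only [onSpan, F₀, coord_sum_smul, RCLike.ofReal_re]
    have hNt : ∀ b, (N b : ℂ) = ∑' l, g l * expSum l b := fun b => (hN b).tsum_eq.symm
    have hNcont : Continuous fun b : D → ℝ => N (extendCoef b) := by
      have h1 : Continuous fun b : D → ℝ => ∑' l, g l * expSum l (extendCoef b) :=
        continuous_tsum (fun l => (continuous_expSum_extendCoef l).const_smul (g l)) hg
          fun l b => by rw [norm_mul, norm_expSum, mul_one]
      refine (Complex.continuous_re.comp h1).congr fun b => ?_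
      simp only [Function.comp, ← hNt, Complex.ofReal_re]
    have hcont : Continuous (onSpan Φ D F₀) := by
      rw [show onSpan Φ D F₀ = fun b => -N (extendCoef b) from funext hF₀]
      exact hNcont.neg
    have hNb : ∀ b, |N b| ≤ ∑' l, ‖g l‖ := by
      intro b
      rw [← Real.norm_eq_abs, ← Complex.norm_real, hNt]
      refine (norm_tsum_le_tsum_norm ?_).trans ?_
      · simpa [norm_expSum] using hg
      · simp [norm_expSum]
    have hpc : ∀ k : ℕ →₀ ℤ, k.support ⊆ D → pieceCoeff Φ D F₀ k = -g k := by
      intro k hk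
      rw [← integral_cube_mul_exp hg hD hk, ← integral_neg, pieceCoeff]
      congr 1
      funext b
      rw [hF₀, ← hNt]
      push_cast
      ring
    have hpc' : ∀ k : ℕ →₀ ℤ, (if k.support ⊆ D then pieceCoeff Φ D F₀ k else 0) = -g k := by
      intro k
      split_ifs with hk
      · exact hpc k hk
      · rw [not_imp_comm.1 (hD k) hk, neg_zero]
    -- The new piece `F₀`, which represents `-N`, takes index `0`, and the pieces of `f` move up by
    -- one.
    let D' : ℕ → Finset ℕ := fun j => match j with
      | 0 => D
      | j + 1 => d.D j
    let F' : ℕ → Ω → ℝ := fun j => match j with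
      | 0 => F₀
      | j + 1 => d.F j
    have hsum' : Summable fun p : (ℕ →₀ ℤ) × ℕ =>
        if p.1.support ⊆ D' p.2 then ‖pieceCoeff Φ (D' p.2) (F' p.2) p.1‖ else 0 := by
      set G : (ℕ →₀ ℤ) × ℕ → ℝ := fun p =>
        if p.1.support ⊆ D' p.2 then ‖pieceCoeff Φ (D' p.2) (F' p.2) p.1‖ else 0 with hG
      have hi₀ : Function.Injective fun k : ℕ →₀ ℤ => (k, 0) := Prod.mk_left_injective 0
      have hi₁ : Function.Injective fun p : (ℕ →₀ ℤ) × ℕ => (p.1, p.2 + 1) := by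
        rintro ⟨k, j⟩ ⟨k', j'⟩ h
        simpa using h
      have h₀ : Summable fun p : (ℕ →₀ ℤ) × ℕ => if p.2 = 0 then G p else 0 := by
        refine (hi₀.summable_iff ?_).1 (hg.congr fun k => ?_)
        · rintro ⟨k, j⟩ hj
          exact if_neg fun h : j = 0 => hj ⟨k, by rw [h]⟩
        · have := congrArg norm (hpc' k)
          rw [norm_neg, apply_ite norm, norm_zero] at this
          exact this.symm
      have h₁ : Summable fun p : (ℕ →₀ ℤ) × ℕ => if p.2 = 0 then 0 else G p := by
        refine (hi₁.summable_iff ?_).1 d.summable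
        rintro ⟨k, j⟩ hj
        refine if_pos (by_contra fun h : j ≠ 0 => hj ⟨(k, j - 1), ?_⟩)
        simp only [Prod.mk.injEq, true_and]
        omega
      refine (h₀.add h₁).congr fun p => ?_
      split_ifs <;> simp
    refine ⟨⟨D', F', fun v => ?_, fun j => ?_, fun j => ?_, hsum'⟩, fun k => ?_⟩
    · rw [← tendsto_add_atTop_iff_nat 1]
      simp only [Finset.sum_range_succ']
      have e : F' 0 (∑ i ∈ D' 0, (coef Φ v i : 𝕜) • Φ.basis i) = -N (coef Φ v) := by
        change F₀ (∑ i ∈ D, (coef Φ v i : 𝕜) • Φ.basis i) = _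
        rw [← Finset.sum_coe_sort]
        refine (hF₀ fun i => coef Φ v i).trans (congrArg Neg.neg (hNc _ _ fun i hi => ?_))
        rw [extendCoef, dif_pos hi]
      rw [e]
      exact (d.tendsto_sum v).add_const _
    · cases j with
      | zero => exact contDiffOn_zero.2 hcont.continuousOn
      | succ j => exact (d.contDiffOn j).of_le (by simp)
    · cases j with
      | zero =>
        have := isFiniteMeasure_restrict_cube D
        refine Integrable.of_bound hcont.aestronglyMeasurable (∑' l, ‖g l‖)
          (Eventually.of_forall fun b => ?_)
        change ‖onSpan Φ D F₀ b‖ ≤ _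
        rw [hF₀, norm_neg]
        exact hNb _
      | succ j => exact d.integrableOn j
    · have hk : Summable fun j => if k.support ⊆ D' j then pieceCoeff Φ (D' j) (F' j) k else 0 := by
        refine Summable.of_norm ((hsum'.comp_injective (Prod.mk_right_injective k)).congr
          fun j => ?_)
        simp only [Function.comp, apply_ite norm, norm_zero]
      beta_reduce
      rw [FourierDecomp.coeff, hk.tsum_eq_zero_add, hd k, FourierDecomp.coeff, sub_eq_neg_add]
      exact congrArg (· + _) (hpc' k).symm
  · have := (hs v).sub (hN (coef Φ v))
    push_cast
    refine this.congr_fun fun l => ?_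
    rw [sub_mul]
    rfl

end

/-! ### Symmetry of the coefficients, a nonzero frequency, and padding of networks -/

section

variable {𝕜 Ω : Type*} [RCLike 𝕜] [NormedAddCommGroup Ω] [NormedSpace 𝕜 Ω]

lemma exists_coef_eq (Φ : SchauderBasis 𝕜 Ω) {b : ℕ → ℝ}
    (hb : ∀ i, b i ∈ Set.Ioo (-(1 / 2) : ℝ) (1 / 2)) (hbf : b.support.Finite) :
    ∃ v : LBound Φ, coef Φ v = b := by
  have hco : ∀ i, Φ.coord i (∑ j : hbf.toFinset, (b j : 𝕜) • Φ.basis j) = (b i : 𝕜) := by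
    intro i
    rw [coord_sum_smul Φ (fun j : hbf.toFinset => b j), extendCoef]
    by_cases hi : b i = 0 <;> simp [hi]
  refine ⟨⟨_, fun i => ⟨b i, hb i, hco i⟩⟩, funext fun i => ?_⟩
  rw [coef, hco, RCLike.ofReal_re]

/-- The Fourier coefficients of a real functional are conjugation symmetric. -/
lemma HasFourierSeries.conj_neg {Φ : SchauderBasis 𝕜 Ω} {r : ℕ} {f : LBound Φ → ℝ}
    {a : (ℕ →₀ ℤ) → ℂ} (h : HasFourierSeries Φ r f a) (k : ℕ →₀ ℤ) :
    (starRingEnd ℂ) (a (-k)) = a k := by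
  have key : ∀ b : ℕ → ℝ, (∀ i, b i ∈ Set.Ioo (-(1 / 2) : ℝ) (1 / 2)) → b.support.Finite →
      HasSum (fun k => (a k - (starRingEnd ℂ) (a (-k))) * expSum k b) 0 := by
    intro b hb hbf
    obtain ⟨v, rfl⟩ := exists_coef_eq Φ hb hbf
    have h1 : HasSum (fun k => a k * expSum k (coef Φ v)) (f v : ℂ) := h.2 v
    have h2 := (Equiv.neg (ℕ →₀ ℤ)).hasSum_iff.2 (Complex.hasSum_conj'.2 h1)
    rw [Complex.conj_ofReal] at h2
    have h3 := h1.sub h2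
    rw [sub_self] at h3
    refine h3.congr_fun fun k => ?_
    have e : (starRingEnd ℂ) (expSum (-k) (coef Φ v)) = expSum k (coef Φ v) := by
      have := pairing_smul (-1) k (coef Φ v)
      rw [neg_one_smul] at this
      rw [expSum_eq_pairing, expSum_eq_pairing, ← Complex.exp_conj, this]
      simp [Complex.conj_ofReal, Complex.conj_ofNat]
    simp only [Function.comp, Equiv.neg_apply, map_mul, e, sub_mul]
  refine (sub_eq_zero.1 (coeff_eq_zero (c := fun k => a k - (starRingEnd ℂ) (a (-k))) ?_
    (fun b hb hbf => (key b hb hbf).tsum_eq) k)).symm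
  have := (key (fun _ => 0) (fun i => by norm_num) (by simp)).summable
  simpa [expSum] using this.norm

/-- Otherwise the series reduces to the constant `a 0`. The index found here serves as the direction
of idle units. -/
lemma HasFourierSeries.exists_ne_zero {Φ : SchauderBasis 𝕜 Ω} {r : ℕ} {f : LBound Φ → ℝ}
    {a : (ℕ →₀ ℤ) → ℂ} (h : HasFourierSeries Φ r f a) (hnc : ∃ u v, f u ≠ f v) :
    ∃ k, k ≠ 0 ∧ a k ≠ 0 := by
  by_contra! H
  have hv : ∀ v, (f v : ℂ) = a 0 := by
    intro v
    refine (h.2 v).unique ?_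
    have := hasSum_single (f := fun k => a k * basisFn Φ k v) 0 fun k hk => by
      simp [H k hk]
    simpa [basisFn] using this
  obtain ⟨u, v, huv⟩ := hnc
  exact huv (by exact_mod_cast (hv u).trans (hv v).symm)

/-- Networks with at most `m` units, given in terms of directions in `ℤ^ℕ`. -/
lemma mem_reluNetworks {Φ : SchauderBasis 𝕜 Ω} {f : LBound Φ → ℝ} {m : ℕ} {τ : Type*} [Fintype τ]
    (hcard : Fintype.card τ ≤ m) {k₀ : ℕ →₀ ℤ} (hk₀ : k₀ ≠ 0) (ha₀ : fourierCoef Φ f k₀ ≠ 0)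
    {c : ℝ} {γ t : τ → ℝ} {k : τ → (ℕ →₀ ℤ)} (hc : 2 * |c| ≤ 4 * barronNorm Φ 2 f)
    (hγ : ∑ j, |γ j| ≤ 4 * barronNorm Φ 2 f) (hk : ∀ j, k j ≠ 0)
    (ha : ∀ j, fourierCoef Φ f (k j) ≠ 0) (ht : ∀ j, |t j| ≤ 1) {g : LBound Φ → ℝ}
    (hg : ∀ v, g v = c + ∑ j, γ j * max 0 (pairing (k j) (coef Φ v) / l1 (k j) - t j)) :
    g ∈ reluNetworks Φ f m := by
  -- Missing units are filled in with outer weight `0` and direction `k₀`, which can be normalized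
  -- because `k₀ ≠ 0`.
  obtain ⟨e⟩ : Nonempty (Fin m ≃ τ ⊕ Fin (m - Fintype.card τ)) :=
    Fintype.card_eq.1 (by simp; omega)
  let k' : τ ⊕ Fin (m - Fintype.card τ) → (ℕ →₀ ℤ) := Sum.elim k fun _ => k₀
  have hk' : ∀ x, k' x ≠ 0 := by rintro (j | j); exacts [hk j, hk₀]
  refine ⟨c, Sum.elim γ (fun _ => 0) ∘ e, Sum.elim t (fun _ => 0) ∘ e, k' ∘ e,
    fun j i => (k' (e j) i : ℝ) / l1 (k' (e j)), hc, ?_, fun j => ?_, fun j => ?_, fun j => ?_,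
    fun v => ?_⟩
  · simp only [Function.comp]
    rw [e.sum_comp fun x => |Sum.elim γ (fun _ => 0) x|, Fintype.sum_sum_type]
    simpa using hγ
  · simp only [Function.comp]
    rcases e j with i | i
    exacts [ha i, ha₀]
  · exact sum_range_len_abs_div (hk' _)
  · simp only [Function.comp]
    rcases e j with i | i
    · exact ht i
    · simp
  · simp only [Function.comp, sum_range_len_mul]
    rw [e.sum_comp fun x => Sum.elim γ (fun _ => 0) x *
      max 0 (pairing (k' x) (coef Φ v) / l1 (k' x) - Sum.elim t (fun _ => 0) x),
      Fintype.sum_sum_type, hg]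
    simp [k']

end

section

/-! ### Sums of triangle waves with well-chosen phases -/

/-- The number of triangle waves used for the frequency `k` at the threshold `ε`. -/
def copies (a : (ℕ →₀ ℤ) → ℂ) (ε : ℝ) (k : ℕ →₀ ℤ) : ℕ := ⌊‖a k‖ / ε⌋₊

/-- The amplitude of each triangle wave used for the frequency `k` at the threshold `ε`. -/
def amp (a : (ℕ →₀ ℤ) → ℂ) (ε : ℝ) (k : ℕ →₀ ℤ) : ℝ := ‖a k‖ / copies a ε k

/-- The triangle waves used for the frequencies in `S`. -/
abbrev Waves (a : (ℕ →₀ ℤ) → ℂ) (ε : ℝ) (S : Finset (ℕ →₀ ℤ)) : Type :=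
  Σ k : S, Fin (copies a ε k)

/-- The Fourier coefficients of a constant plus a sum of triangle waves with phases `s`. -/
def netCoeff (a : (ℕ →₀ ℤ) → ℂ) (ε : ℝ) (S : Finset (ℕ →₀ ℤ)) (s : Waves a ε S → ℝ)
    (l : ℕ →₀ ℤ) : ℂ :=
  (if l = 0 then a 0 else 0) + ∑ j : Waves a ε S, (amp a ε j.1 : ℂ) * waveCoeff j.1 (s j) l

/-- A constant plus a sum of triangle waves with phases `s`. -/
def netFn (a : (ℕ →₀ ℤ) → ℂ) (ε : ℝ) (S : Finset (ℕ →₀ ℤ)) (s : Waves a ε S → ℝ)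
    (b : ℕ → ℝ) : ℝ :=
  (a 0).re + ∑ j : Waves a ε S, amp a ε j.1 * triWave (pairing j.1 b - s j)

variable {a : (ℕ →₀ ℤ) → ℂ} {ε : ℝ} {S : Finset (ℕ →₀ ℤ)}

lemma amp_nonneg (a : (ℕ →₀ ℤ) → ℂ) (ε : ℝ) (k : ℕ →₀ ℤ) : 0 ≤ amp a ε k := by
  unfold amp; positivity

lemma copies_pos (hε : 0 < ε) {k : ℕ →₀ ℤ} (hk : ε ≤ ‖a k‖) : 0 < copies a ε k :=
  Nat.floor_pos.2 ((one_le_div hε).2 hk)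

lemma copies_le (hε : 0 < ε) (k : ℕ →₀ ℤ) : (copies a ε k : ℝ) ≤ ‖a k‖ / ε :=
  Nat.floor_le (by positivity)

lemma copies_mul_amp (hε : 0 < ε) {k : ℕ →₀ ℤ} (hk : ε ≤ ‖a k‖) :
    copies a ε k * amp a ε k = ‖a k‖ := by
  have : (0 : ℝ) < copies a ε k := by exact_mod_cast copies_pos hε hk
  rw [amp, mul_div_cancel₀ _ this.ne']

/-- For `x ≥ 1` one has `x < ⌊x⌋ + 1 ≤ 2 ⌊x⌋`. -/
lemma amp_le (hε : 0 < ε) {k : ℕ →₀ ℤ} (hk : ε ≤ ‖a k‖) : amp a ε k ≤ 2 * ε := by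
  have h0 : (1 : ℝ) ≤ copies a ε k := by exact_mod_cast copies_pos hε hk
  have h1 : ‖a k‖ / ε < copies a ε k + 1 := Nat.lt_floor_add_one _
  rw [div_lt_iff₀ hε] at h1
  rw [amp, div_le_iff₀ (by linarith)]
  nlinarith

lemma sum_waves {R : Type*} [CommSemiring R] (F : (ℕ →₀ ℤ) → R) :
    ∑ j : Waves a ε S, F j.1 = ∑ k ∈ S, (copies a ε k : R) * F k := by
  rw [Fintype.sum_sigma, ← Finset.sum_coe_sort S fun k => (copies a ε k : R) * F k]
  simp

lemma sum_weight_le (hs : Summable fun k => weight k * ‖a k‖) (T : Finset (ℕ →₀ ℤ)) :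
    ∑ k ∈ T, weight k * ‖a k‖ ≤ ∑' k, weight k * ‖a k‖ :=
  hs.sum_le_tsum T fun k _ => mul_nonneg (weight_pos k).le (norm_nonneg _)

lemma sum_waves_amp_weight (hε : 0 < ε) (hS : ∀ k, k ∈ S ↔ k ≠ 0 ∧ ε ≤ ‖a k‖) :
    ∑ j : Waves a ε S, amp a ε j.1 * weight j.1 = ∑ k ∈ S, weight k * ‖a k‖ := by
  rw [sum_waves fun k => amp a ε k * weight k]
  refine Finset.sum_congr rfl fun k hk => ?_
  rw [← mul_assoc, copies_mul_amp hε ((hS k).1 hk).2, mul_comm]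

/-- By conjugation symmetry `S` is closed under negation, and the frequency `l` receives one half of
`a l` from `k = l` and the other from `k = -l`. -/
lemma sum_waves_cosCoeff (hε : 0 < ε) (hS : ∀ k, k ∈ S ↔ k ≠ 0 ∧ ε ≤ ‖a k‖)
    (hconj : ∀ k, (starRingEnd ℂ) (a (-k)) = a k) (l : ℕ →₀ ℤ) :
    ∑ j : Waves a ε S, (amp a ε j.1 : ℂ) * cosCoeff j.1 (a j.1 / ‖a j.1‖) l =
      if l ∈ S then a l else 0 := by
  have hneg : -l ∈ S ↔ l ∈ S := by
    rw [hS, hS, neg_ne_zero, ← hconj l, RCLike.norm_conj]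
  rw [sum_waves fun k => (amp a ε k : ℂ) * cosCoeff k (a k / ‖a k‖) l]
  have e : ∀ k ∈ S, (copies a ε k : ℂ) * ((amp a ε k : ℂ) * cosCoeff k (a k / ‖a k‖) l) =
      (if l = k then a k / 2 else 0) + (if -l = k then (starRingEnd ℂ) (a k) / 2 else 0) := by
    intro k hk
    have h1 := copies_mul_amp hε ((hS k).1 hk).2
    have h2 : (‖a k‖ : ℂ) ≠ 0 := by
      exact_mod_cast (hε.trans_le ((hS k).1 hk).2).ne'
    rw [← mul_assoc, show (copies a ε k : ℂ) * (amp a ε k : ℂ) = ‖a k‖ by exact_mod_cast h1,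
      cosCoeff, map_div₀, Complex.conj_ofReal, mul_add]
    simp only [neg_eq_iff_eq_neg, mul_ite, mul_zero]
    congr 2 <;> field_simp
  rw [Finset.sum_congr rfl e, Finset.sum_add_distrib, Finset.sum_ite_eq, Finset.sum_ite_eq]
  simp only [hneg]
  split_ifs
  · rw [hconj]; ring
  · simp

/-- There are phases for which the sum of triangle waves is close to the functional with Fourier
coefficients `a`. -/
lemma exists_phases (hs : Summable fun k => weight k * ‖a k‖) (hε : 0 < ε)
    (hS : ∀ k, k ∈ S ↔ k ≠ 0 ∧ ε ≤ ‖a k‖) (hconj : ∀ k, (starRingEnd ℂ) (a (-k)) = a k) :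
    ∃ s : Waves a ε S → ℝ, (Summable fun l => weight l * ‖a l - netCoeff a ε S s l‖ ^ 2) ∧
      ∑' l, weight l * ‖a l - netCoeff a ε S s l‖ ^ 2 ≤
        21 * ε * ∑' k, weight k * ‖a k‖ := by
  classical
  let u : (ℕ →₀ ℤ) → ℂ := fun k => a k / ‖a k‖
  have hu : ∀ k, ‖u k‖ ≤ 1 := fun k => by
    simp only [u, norm_div, Complex.norm_real, norm_norm]
    exact div_self_le_one _
  -- The deterministic part of the error: the dropped frequencies, all with `‖a l‖ ≤ ε`.
  let y : (ℕ →₀ ℤ) → ℂ := fun l => if l = 0 ∨ l ∈ S then 0 else a l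
  have hyle : ∀ l, weight l * ‖y l‖ ^ 2 ≤ ε * (weight l * ‖a l‖) := by
    intro l
    have hw := (weight_pos l).le
    simp only [y]
    split_ifs with h
    · simp; positivity
    · have hl : ‖a l‖ ≤ ε := by
        by_contra! H
        exact h (or_iff_not_imp_left.2 fun h0 => (hS l).2 ⟨h0, H.le⟩)
      calc weight l * ‖a l‖ ^ 2 = ‖a l‖ * (weight l * ‖a l‖) := by ring
        _ ≤ ε * (weight l * ‖a l‖) := by gcongr
  have hy : Summable fun l => weight l * ‖y l‖ ^ 2 :=
    Summable.of_nonneg_of_le (fun l => mul_nonneg (weight_pos l).le (sq_nonneg _)) hyle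
      (hs.mul_left ε)
  have hne : ∀ j : Waves a ε S, (j.1 : ℕ →₀ ℤ) ≠ 0 := fun j => ((hS _).1 j.1.2).1
  have hle : ∀ j : Waves a ε S, ε ≤ ‖a j.1‖ := fun j => ((hS _).1 j.1.2).2
  have hprob : ∀ j : Waves a ε S, IsProbabilityMeasure (phaseMeasure (u j.1)) := fun j =>
    isProbabilityMeasure_phaseMeasure (hu _)
  have hXe : ∀ (j : Waves a ε S) l, weight l * (amp a ε j.1 * waveBound j.1 l) ^ 2 =
      amp a ε j.1 ^ 2 * (weight l * waveBound j.1 l ^ 2) := fun j l => by ring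
  obtain ⟨s, hsum, hbd⟩ := exists_tsum_norm_add_sum_sq_le (S := ℝ)
    (fun j : Waves a ε S => phaseMeasure (u j.1)) (fun l => (weight_pos l).le) hy
    (x := fun j s l => (-amp a ε j.1 : ℂ) * (waveCoeff j.1 s l - cosCoeff j.1 (u j.1) l))
    (X := fun j l => amp a ε j.1 * waveBound j.1 l)
    (fun j l => ((measurable_waveCoeff (hne j) l).sub_const _).const_mul _)
    (fun j s l => by
      rw [norm_mul, norm_neg, Complex.norm_real, Real.norm_of_nonneg (amp_nonneg _ _ _)]
      exact mul_le_mul_of_nonneg_left (norm_waveCoeff_sub_cosCoeff_le (hne j) (hu _) s l)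
        (amp_nonneg _ _ _))
    (fun j => by
      simp only [hXe]
      exact (summable_waveBound (hne j)).1.mul_left _)
    (fun j l => by
      rw [integral_const_mul, integral_waveCoeff_sub_cosCoeff (hne j) (hu _), mul_zero])
    Finset.univ
  have e : ∀ l, y l + ∑ j : Waves a ε S,
      (-amp a ε j.1 : ℂ) * (waveCoeff j.1 (s j) l - cosCoeff j.1 (u j.1) l) =
      a l - netCoeff a ε S s l := by
    intro l
    have h0 : (0 : ℕ →₀ ℤ) ∉ S := fun h => ((hS 0).1 h).1 rfl
    simp only [neg_mul, mul_sub, Finset.sum_neg_distrib, Finset.sum_sub_distrib]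
    rw [sum_waves_cosCoeff hε hS hconj, netCoeff]
    simp only [y]
    by_cases hl : l = 0
    · subst hl; simp [h0]
    · by_cases hlS : l ∈ S <;> simp [hl, hlS] <;> ring
  simp only [e] at hsum hbd
  refine ⟨s, hsum, hbd.trans ?_⟩
  have h1 : ∑' l, weight l * ‖y l‖ ^ 2 ≤ ε * ∑' k, weight k * ‖a k‖ := by
    rw [← tsum_mul_left]
    exact hy.tsum_le_tsum hyle (hs.mul_left ε)
  -- One factor `amp` is bounded by `2 ε`; the other is kept, since the sum of `amp * weight` over
  -- the waves is bounded by the Barron norm.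
  have hj : ∀ j : Waves a ε S, ∑' l, weight l * (amp a ε j.1 * waveBound j.1 l) ^ 2 ≤
      20 * ε * (amp a ε j.1 * weight j.1) := by
    intro j
    simp only [hXe]
    rw [tsum_mul_left]
    have hA := amp_nonneg a ε j.1
    have hA' := amp_le hε (hle j)
    have hw := weight_pos (j.1 : ℕ →₀ ℤ)
    calc amp a ε j.1 ^ 2 * ∑' l, weight l * waveBound j.1 l ^ 2
        ≤ amp a ε j.1 ^ 2 * (10 * weight j.1) := by
          gcongr; exact (summable_waveBound (hne j)).2
      _ = amp a ε j.1 * (10 * (amp a ε j.1 * weight j.1)) := by ring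
      _ ≤ (2 * ε) * (10 * (amp a ε j.1 * weight j.1)) := by gcongr
      _ = _ := by ring
  have h2 : ∑ j : Waves a ε S, ∑' l, weight l * (amp a ε j.1 * waveBound j.1 l) ^ 2 ≤
      20 * ε * ∑' k, weight k * ‖a k‖ := by
    calc ∑ j : Waves a ε S, ∑' l, weight l * (amp a ε j.1 * waveBound j.1 l) ^ 2
        ≤ ∑ j : Waves a ε S, 20 * ε * (amp a ε j.1 * weight j.1) :=
          Finset.sum_le_sum fun j _ => hj j
      _ = 20 * ε * ∑ k ∈ S, weight k * ‖a k‖ := by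
          rw [← Finset.mul_sum, sum_waves_amp_weight hε hS]
      _ ≤ 20 * ε * ∑' k, weight k * ‖a k‖ := by gcongr; exact sum_weight_le hs S
  linarith

lemma summable_norm_netCoeff (h0 : 0 ∉ S) (s : Waves a ε S → ℝ) :
    Summable fun l => ‖netCoeff a ε S s l‖ := by
  have hne : ∀ j : Waves a ε S, (j.1 : ℕ →₀ ℤ) ≠ 0 := fun j h => h0 (h ▸ j.1.2)
  have h1 : Summable fun l : ℕ →₀ ℤ => if l = 0 then a 0 else 0 := (hasSum_ite_eq 0 (a 0)).summable
  refine (h1.add (summable_sum fun j _ => ?_)).norm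
  exact (summable_norm_waveCoeff (hne j) (s j)).of_norm.mul_left _

lemma support_subset_of_netCoeff_ne_zero {s : Waves a ε S → ℝ} {l : ℕ →₀ ℤ}
    (h : netCoeff a ε S s l ≠ 0) : l.support ⊆ S.biUnion fun k => k.support := by
  by_contra hl
  refine h ?_
  rw [netCoeff, if_neg, zero_add, Finset.sum_eq_zero]
  · intro j _
    rw [not_imp_comm.1 support_subset_of_waveCoeff_ne_zero, mul_zero]
    exact fun h' => hl (h'.trans (Finset.subset_biUnion_of_mem (fun k : ℕ →₀ ℤ => k.support) j.1.2))
  · rintro rfl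
    simp at hl

lemma hasSum_netCoeff (h0 : 0 ∉ S) (hre : (starRingEnd ℂ) (a 0) = a 0) (s : Waves a ε S → ℝ)
    (b : ℕ → ℝ) :
    HasSum (fun l => netCoeff a ε S s l * expSum l b) (netFn a ε S s b : ℂ) := by
  have hne : ∀ j : Waves a ε S, (j.1 : ℕ →₀ ℤ) ≠ 0 := fun j h => h0 (h ▸ j.1.2)
  have h1 := hasSum_ite_eq (0 : ℕ →₀ ℤ) (a 0)
  have h2 := hasSum_sum (s := Finset.univ) fun (j : Waves a ε S) _ =>
    (hasSum_waveCoeff (hne j) (s j) b).mul_left (amp a ε j.1 : ℂ)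
  rw [netFn]
  push_cast
  rw [Complex.conj_eq_iff_re.1 hre]
  refine (h1.add h2).congr_fun fun l => ?_
  rw [netCoeff, add_mul, Finset.sum_mul]
  congr 1
  · split_ifs with hl
    · subst hl; simp [expSum]
    · simp
  · exact Finset.sum_congr rfl fun j _ => by ring

variable {𝕜 Ω : Type*} [RCLike 𝕜] [NormedAddCommGroup Ω] [NormedSpace 𝕜 Ω]

/-- On the domain, the sum of triangle waves is a network with at most `m` units. -/
lemma netFn_mem_reluNetworks {Φ : SchauderBasis 𝕜 Ω} {f : LBound Φ → ℝ}
    (ha : fourierCoef Φ f = a) (hs : Summable fun k => weight k * ‖a k‖) (hε : 0 < ε) {m : ℕ}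
    (hm : barronNorm Φ 2 f ≤ ε * m)
    (hS : ∀ k, k ∈ S ↔ k ≠ 0 ∧ ε ≤ ‖a k‖) {k₀ : ℕ →₀ ℤ} (hk₀ : k₀ ≠ 0)
    (ha₀ : a k₀ ≠ 0) (s : Waves a ε S → ℝ) :
    (fun v => netFn a ε S s (coef Φ v)) ∈ reluNetworks Φ f m := by
  classical
  have hA : barronNorm Φ 2 f = ∑' k, weight k * ‖a k‖ := by rw [← ha]; rfl
  have hA0 : 0 ≤ barronNorm Φ 2 f :=
    tsum_nonneg fun k => mul_nonneg (weight_pos k).le (norm_nonneg _)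
  have hne : ∀ j : Waves a ε S, (j.1 : ℕ →₀ ℤ) ≠ 0 := fun j => ((hS _).1 j.1.2).1
  have hle : ∀ j : Waves a ε S, ε ≤ ‖a j.1‖ := fun j => ((hS _).1 j.1.2).2
  let n : (ℕ →₀ ℤ) → ℕ := fun k => ∑ i ∈ k.support, (k i).natAbs
  have hn : ∀ k, l1 k = n k := l1_eq_natCast
  choose c γ t hc hγ ht hwave using fun j : Waves a ε S =>
    exists_relu_triWave (hne j) (hn j.1) (s j)
  have hS0 : (0 : ℕ →₀ ℤ) ∉ S := fun h => ((hS 0).1 h).1 rfl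
  refine mem_reluNetworks (τ := Σ j : Waves a ε S, Fin (2 * n j.1 + 1)) ?_ hk₀ (ha ▸ ha₀)
    (c := (a 0).re + ∑ j, amp a ε j.1 * c j) (γ := fun x => amp a ε x.1.1 * γ x.1 x.2)
    (t := fun x => t x.1 x.2) (k := fun x => x.1.1) ?_ ?_ (fun x => hne x.1)
    (fun x => by rw [ha]; exact norm_pos_iff.1 (hε.trans_le (hle x.1)))
    (fun x => ht x.1 x.2) fun v => ?_
  · rw [Fintype.card_sigma]
    simp only [Fintype.card_fin]
    -- The quadratic weight pays for the units of a wave: `2 n + 1 ≤ 1 + 4 π² n²`.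
    have h1 : ∀ k : ℕ →₀ ℤ, ((2 * n k + 1 : ℕ) : ℝ) ≤ weight k := by
      intro k
      have h1 : (n k : ℝ) ≤ (n k : ℝ) ^ 2 := by exact_mod_cast Nat.le_self_pow two_ne_zero _
      have h2 : (1 : ℝ) ≤ Real.pi ^ 2 := by nlinarith [Real.pi_gt_three]
      rw [weight, hn k]
      push_cast
      nlinarith [mul_le_mul h2 h1 (by positivity) (by positivity)]
    have h2 : ((∑ j : Waves a ε S, (2 * n j.1 + 1) : ℕ) : ℝ) * ε ≤ m * ε := by
      rw [sum_waves fun k => 2 * n k + 1, Nat.cast_sum, Finset.sum_mul]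
      calc ∑ k ∈ S, ((copies a ε k * (2 * n k + 1) : ℕ) : ℝ) * ε
          ≤ ∑ k ∈ S, weight k * ‖a k‖ := by
            refine Finset.sum_le_sum fun k _ => ?_
            have h3 : copies a ε k * ε ≤ ‖a k‖ := (le_div_iff₀ hε).1 (copies_le hε k)
            rw [Nat.cast_mul, mul_right_comm, mul_comm]
            exact mul_le_mul (h1 k) h3 (by positivity) (weight_pos k).le
        _ ≤ barronNorm Φ 2 f := hA ▸ sum_weight_le hs S
        _ ≤ m * ε := by linarith
    exact_mod_cast le_of_mul_le_mul_right h2 hε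
  · have h1 : |(a 0).re + ∑ j, amp a ε j.1 * c j| ≤ barronNorm Φ 2 f := by
      calc |(a 0).re + ∑ j, amp a ε j.1 * c j|
          ≤ |(a 0).re| + ∑ j : Waves a ε S, |amp a ε j.1 * c j| :=
            (abs_add_le _ _).trans (by gcongr; exact Finset.abs_sum_le_sum_abs _ _)
        _ ≤ weight 0 * ‖a 0‖ + ∑ j : Waves a ε S, amp a ε j.1 * weight j.1 := by
            gcongr with j
            · exact (Complex.abs_re_le_norm _).trans
                (le_mul_of_one_le_left (norm_nonneg _) (one_le_weight 0))
            · rw [abs_mul, abs_of_nonneg (amp_nonneg _ _ _)]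
              exact mul_le_mul_of_nonneg_left (hc j) (amp_nonneg _ _ _)
        _ = ∑ k ∈ insert 0 S, weight k * ‖a k‖ := by
            rw [sum_waves_amp_weight hε hS, Finset.sum_insert hS0]
        _ ≤ barronNorm Φ 2 f := hA ▸ sum_weight_le hs _
    linarith
  · rw [Fintype.sum_sigma]
    calc ∑ j : Waves a ε S, ∑ i, |amp a ε j.1 * γ j i|
        ≤ ∑ j : Waves a ε S, 4 * (amp a ε j.1 * weight j.1) := by
          refine Finset.sum_le_sum fun j _ => ?_
          simp only [abs_mul, abs_of_nonneg (amp_nonneg a ε _)]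
          rw [← Finset.mul_sum]
          linarith [mul_le_mul_of_nonneg_left (hγ j) (amp_nonneg a ε j.1)]
      _ = 4 * ∑ k ∈ S, weight k * ‖a k‖ := by
          rw [← Finset.mul_sum, sum_waves_amp_weight hε hS]
      _ ≤ 4 * barronNorm Φ 2 f := by rw [hA]; gcongr; exact sum_weight_le hs S
  · have hv : ∀ i, |coef Φ v i| ≤ 1 / 2 := fun i =>
      abs_le.2 ⟨(coef_mem_Ioo Φ v i).1.le, (coef_mem_Ioo Φ v i).2.le⟩
    rw [netFn, add_assoc, Fintype.sum_sigma (α := fun j : Waves a ε S => Fin (2 * n j.1 + 1)),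
      ← Finset.sum_add_distrib]
    congr 1
    refine Finset.sum_congr rfl fun j _ => ?_
    rw [hwave j _ hv, mul_add, Finset.mul_sum]
    congr 1
    exact Finset.sum_congr rfl fun i _ => by ring

end

end BarronFunctional

end


/-! ### Choice of the threshold and the final estimate -/

open BarronFunctional in
theorem theorem3p1 {𝕜 Ω : Type*} [RCLike 𝕜] [NormedAddCommGroup Ω] [NormedSpace 𝕜 Ω]
    (Φ : SchauderBasis 𝕜 Ω) (f : LBound Φ → ℝ) (hf : MemBarron Φ 2 f)
    (hnc : ∃ u v, f u ≠ f v) (m : ℕ) (hm : 1 ≤ m) :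
    ∃ fm ∈ reluNetworks Φ f m,
      MemHilbert Φ 1 (f - fm) ∧
      hilbertNorm Φ 1 (f - fm) ≤ 4 * √5 * barronNorm Φ 2 f / √(m : ℝ) := by
  obtain ⟨-, hF, hs⟩ := hf
  replace hs : Summable fun k => weight k * ‖fourierCoef Φ f k‖ := hs
  obtain ⟨k₀, hk₀, ha₀⟩ := hF.exists_ne_zero hnc
  have hA : barronNorm Φ 2 f = ∑' k, weight k * ‖fourierCoef Φ f k‖ := rfl
  have hm0 : (0 : ℝ) < m := by exact_mod_cast hm
  have hA0 : 0 < barronNorm Φ 2 f := by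
    rw [hA]
    exact hs.tsum_pos (fun k => mul_nonneg (weight_pos k).le (norm_nonneg _)) k₀
      (mul_pos (weight_pos _) (norm_pos_iff.2 ha₀))
  set a := fourierCoef Φ f
  set A := barronNorm Φ 2 f
  -- The threshold for which the bound `A / ε` on the number of units equals `m`.
  set ε := A / m with hε_def
  have hε : 0 < ε := by positivity
  have hsa : Summable fun k => ‖a k‖ :=
    hs.of_nonneg_of_le (fun k => norm_nonneg _)
      fun k => le_mul_of_one_le_left (norm_nonneg _) (one_le_weight k)
  -- Summable coefficients tend to zero, so only finitely many frequencies get waves.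
  have hfin : {k | k ≠ 0 ∧ ε ≤ ‖a k‖}.Finite := by
    have := hsa.tendsto_cofinite_zero.eventually_lt_const hε
    rw [eventually_cofinite] at this
    exact this.subset fun k hk => not_lt.2 hk.2
  have hS : ∀ k, k ∈ hfin.toFinset ↔ k ≠ 0 ∧ ε ≤ ‖a k‖ := fun k => by simp
  have hS0 : (0 : ℕ →₀ ℤ) ∉ hfin.toFinset := fun h => ((hS 0).1 h).1 rfl
  have hre : (starRingEnd ℂ) (a 0) = a 0 := by simpa using hF.conj_neg 0
  obtain ⟨s, hsum, hle⟩ := exists_phases hs hε hS hF.conj_neg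
  refine ⟨_, netFn_mem_reluNetworks rfl hs hε (div_mul_cancel₀ _ hm0.ne').ge hS hk₀ ha₀ s, ?_⟩
  have hsub := hF.sub_finite (summable_norm_netCoeff hS0 s)
    (fun l hl => support_subset_of_netCoeff_ne_zero hl) (hasSum_netCoeff hS0 hre s)
  have hcoef : fourierCoef Φ (f - fun v => netFn a ε hfin.toFinset s (coef Φ v)) =
      fun l => a l - netCoeff a ε hfin.toFinset s l := hsub.fourierCoef_eq
  refine ⟨⟨?_, ?_⟩, ?_⟩
  · rw [hcoef]; exact hsub
  · rw [hcoef]; exact hsum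
  · rw [hilbertNorm, hcoef]
    refine Real.sqrt_le_iff.2 ⟨by positivity, hle.trans ?_⟩
    rw [← hA, div_pow, mul_pow, mul_pow, Real.sq_sqrt hm0.le, Real.sq_sqrt (by norm_num)]
    have : 0 ≤ A ^ 2 / m := by positivity
    -- Here `80 = (4√5)²`, so the constant has room to spare.
    calc 21 * ε * A = 21 * (A ^ 2 / m) := by rw [hε_def]; ring
      _ ≤ 80 * (A ^ 2 / m) := by linarith
      _ = 4 ^ 2 * 5 * A ^ 2 / m := by ring
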